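/- Let $N\ge 0$, $L\ge 1$, $S\ge 1$ be integers. Write $\sigma_0=I,\ \sigma_1=X,\ \sigma_2=Y,\ \sigma_3=Z$ for the Pauli matrices and $\sigma_{\boldsymbol i}=\sigma_{i_1}\otimes\cdots\otimes\sigma_{i_N}$ for $\boldsymbol i\in\{0,1,2,3\}^N$. Let $\mathcal N$ be any set of vectors $\boldsymbol i\in\{0,1,2,3\}^N$ each having at least $1$ and at most $S$ nonzero entries, and let $H=\sum_{\boldsymbol i\in\mathcal N}\sigma_{\boldsymbol i}$. For $l=1,\dots,L$ let $\mathrm{CZ}_l$ be a product of controlled-$Z$ gates on arbitrarily many (arbitrarily chosen) pairs of distinct qubits, and for $\boldsymbol\theta=(\theta_{q,n})_{1\le q\le 2L,\,1\le n\le N}\in\mathbb R^{2LN}$ put $$U(\boldsymbol\theta)=U_L\cdots U_1,\qquad U_l=\Big(\bigotimes_{n=1}^N e^{-\frac i2\theta_{2l,n}Y}\Big)\Big(\bigotimes_{n=1}^N e^{-\frac i2\theta_{2l-1,n}X}\Big)\mathrm{CZ}_l .$$ Let $C(\boldsymbol\theta)=\mathrm{Tr}\big[H\,U(\boldsymbol\theta)|0\rangle\langle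 0|U(\boldsymbol\theta)^\dagger\big]$, where $|0\rangle=|0\rangle^{\otimes N}$, and let the parameters $\theta_{q,n}$ be independent and uniformly distributed on $[-a\pi,a\pi]$, where $a>0$. Put $$\alpha=\tfrac14\Big(2+\frac{\sin 2a\pi}{a\pi}\Big),\qquad \beta=\tfrac14\Big(2-\frac{\sin 2a\pi}{a\pi}\Big).$$ (1) The function $C$ is differentiable, $\|\nabla C\|_2^2$ is integrable, and $$\mathbb E_{\boldsymbol\theta}\,\|\nabla_{\boldsymbol\theta}C\|_2^2\ \ge\ 2|\mathcal N|(L-1)\,\alpha^{2SL-1}\beta^{S+1}.$$ (2) If moreover $a$ satisfies $$\frac{\sin 2a\pi}{2a\pi}=\frac{S(2L-1)-2}{S(2L+1)},\tag{$*$}$$ then $$\mathbb E_{\boldsymbol\theta}\,\|\nabla_{\boldsymbol\theta}C\|_2^2\ \ge\ 2|\mathcal N|\Big(\frac{S+1}{eS}\Big)^{S+1}\frac{L-1}{(2L+1)^{S+1}} .$$ (3) For all integers $S\ge 1$, $L\ge 1$ with $(S,L)\ne(1,1)$, equation $(*)$ has exactly one solution $a\in(0,1)$. It is of order $\Theta(1/\sqrt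 L)$: there are absolute constants $c_1,c_2>0$ such that every solution $a\in(0,1)$ of $(*)$, for any integers $S,L\ge 1$, satisfies $c_1/\sqrt L\le a\le c_2/\sqrt L$. -/

import Mathlib

open MeasureTheory ProbabilityTheory

noncomputable section

namespace VQE

/-- The Pauli matrices `σ₀ = I`, `σ₁ = X`, `σ₂ = Y`, `σ₃ = Z`. -/
def pauli : Fin 4 → Matrix (Fin 2) (Fin 2) ℂ :=
  ![!![1, 0; 0, 1], !![0, 1; 1, 0], !![0, -Complex.I; Complex.I, 0], !![1, 0; 0, -1]]

/-- Computational basis labels of an `N`-qubit system: bit strings. -/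
abbrev Bits (N : ℕ) := Fin N → Fin 2

/-- Operators on `N` qubits, as matrices in the computational basis. -/
abbrev Operator (N : ℕ) := Matrix (Bits N) (Bits N) ℂ

/-- The tensor product `A₁ ⊗ ⋯ ⊗ A_N` of single-qubit operators. -/
def tensor {N : ℕ} (A : Fin N → Matrix (Fin 2) (Fin 2) ℂ) : Operator N :=
  Matrix.of fun x y => ∏ n, A n (x n) (y n)

/-- The Pauli string `σ_{i₁} ⊗ ⋯ ⊗ σ_{i_N}`. -/
def pauliString {N : ℕ} (i : Fin N → Fin 4) : Operator N :=
  tensor fun n => pauli (i n)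

/-- The number of non-identity components of a Pauli string. -/
def locality {N : ℕ} (i : Fin N → Fin 4) : ℕ :=
  (Finset.univ.filter fun n => i n ≠ 0).card

/-- The Hamiltonian `H = ∑_{i ∈ 𝒩} σ_i`. -/
def hamiltonian {N : ℕ} (𝒩 : Finset (Fin N → Fin 4)) : Operator N :=
  ∑ i ∈ 𝒩, pauliString i

/-- The single-qubit rotation `e^{-i (t/2) G}`. -/
def rotation (G : Matrix (Fin 2) (Fin 2) ℂ) (t : ℝ) : Matrix (Fin 2) (Fin 2) ℂ :=
  NormedSpace.exp ((-Complex.I * ((t : ℂ) / 2)) • G)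

/-- The rotation `R_X(t)`. -/
def rotX (t : ℝ) : Matrix (Fin 2) (Fin 2) ℂ := rotation (pauli 1) t

/-- The rotation `R_Y(t)`. -/
def rotY (t : ℝ) : Matrix (Fin 2) (Fin 2) ℂ := rotation (pauli 2) t

/-- Pairs of distinct qubits. -/
abbrev QubitPair (N : ℕ) := {p : Fin N × Fin N // p.1 ≠ p.2}

/-- The controlled-`Z` gate on two distinct qubits (the identity on all others): the basis vector
`|x⟩` gets the sign `-1` exactly when both qubits are in state `1`. -/
def czGate {N : ℕ} (p : QubitPair N) : Operator N :=
  Matrix.diagonal fun x => if x p.1.1 = 1 ∧ x p.1.2 = 1 then -1 else 1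

/-- An entanglement layer: finitely many (arbitrarily chosen) controlled-`Z` gates. -/
def czLayer {N : ℕ} (E : List (QubitPair N)) : Operator N :=
  (E.map czGate).prod

/-- Index set of the `2NL` parameters. Counting blocks from `0`, `(l, 0, j)` labels the `R_X` angle
and `(l, 1, j)` labels the `R_Y` angle of qubit `j` in block `l`. -/
abbrev ParamIndex (L N : ℕ) := Fin L × Fin 2 × Fin N

/-- Parameter vectors, with the Euclidean norm. -/
abbrev Params (L N : ℕ) := EuclideanSpace ℝ (ParamIndex L N)

/-- One block: first the entanglement layer, then `R_X` on every qubit, then `R_Y` on every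
qubit. -/
def block {L N : ℕ} (E : Fin L → List (QubitPair N)) (θ : Params L N) (l : Fin L) : Operator N :=
  tensor (fun j => rotY (θ (l, 1, j))) * tensor (fun j => rotX (θ (l, 0, j))) * czLayer (E l)

/-- The ansatz unitary `U(θ) = U_L ⋯ U₁`. -/
def ansatz {L N : ℕ} (E : Fin L → List (QubitPair N)) (θ : Params L N) : Operator N :=
  (List.ofFn fun l => block E θ l).reverse.prod

/-- The initial state `|0⟩⟨0|`, with `|0⟩ = |0⋯0⟩`. -/
def zeroState (N : ℕ) : Operator N :=
  Matrix.single 0 0 1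

/-- `Tr[H U(θ) |0⟩⟨0| U(θ)†]`. -/
def costTrace {L N : ℕ} (𝒩 : Finset (Fin N → Fin 4)) (E : Fin L → List (QubitPair N))
    (θ : Params L N) : ℂ :=
  (hamiltonian 𝒩 * ansatz E θ * zeroState N * (ansatz E θ).conjTranspose).trace

/-- The cost function `C(θ) = Tr[H U(θ) |0⟩⟨0| U(θ)†]` as a real number (the trace is real, see
`ofReal_cost`). -/
def cost {L N : ℕ} (𝒩 : Finset (Fin N → Fin 4)) (E : Fin L → List (QubitPair N))
    (θ : Params L N) : ℝ :=
  (costTrace 𝒩 E θ).re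

lemma pauli_isHermitian (k : Fin 4) : (pauli k).conjTranspose = pauli k := by
  fin_cases k <;> ext i j <;> fin_cases i <;> fin_cases j <;> simp [pauli]

lemma pauliString_isHermitian {N : ℕ} (i : Fin N → Fin 4) :
    (pauliString i).conjTranspose = pauliString i := by
  ext x y
  simp only [pauliString, tensor, Matrix.conjTranspose_apply, Matrix.of_apply, star_prod]
  refine Finset.prod_congr rfl fun n _ => ?_
  rw [← Matrix.conjTranspose_apply, pauli_isHermitian]

lemma ofReal_cost {L N : ℕ} (𝒩 : Finset (Fin N → Fin 4)) (E : Fin L → List (QubitPair N))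
    (θ : Params L N) : (cost 𝒩 E θ : ℂ) = costTrace 𝒩 E θ := by
  have hH : (hamiltonian 𝒩).conjTranspose = hamiltonian 𝒩 := by
    simp [hamiltonian, Matrix.conjTranspose_sum, pauliString_isHermitian]
  have hZ : (zeroState N).conjTranspose = zeroState N := by
    simp [zeroState, Matrix.conjTranspose_single]
  refine Complex.conj_eq_iff_re.mp ?_
  change star _ = _
  rw [costTrace, ← Matrix.trace_conjTranspose]
  simp only [Matrix.conjTranspose_mul, Matrix.conjTranspose_conjTranspose, hH, hZ]
  rw [← Matrix.mul_assoc, ← Matrix.mul_assoc, Matrix.trace_mul_comm]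
  simp only [Matrix.mul_assoc]

/-- The law of the parameters: independent, each uniform on `[-aπ, aπ]`. -/
def paramLaw (L N : ℕ) (a : ℝ) : Measure (ParamIndex L N → ℝ) :=
  Measure.pi fun _ => cond volume (Set.Icc (-(a * Real.pi)) (a * Real.pi))

/-- The squared norm `‖∇C(θ)‖₂²`. -/
def gradSq {L N : ℕ} (𝒩 : Finset (Fin N → Fin 4)) (E : Fin L → List (QubitPair N))
    (θ : ParamIndex L N → ℝ) : ℝ :=
  ‖gradient (cost 𝒩 E) (WithLp.toLp 2 θ)‖ ^ 2

/-- `α = (2 + sin(2aπ)/(aπ)) / 4`. -/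
def alpha (a : ℝ) : ℝ := (2 + Real.sin (2 * a * Real.pi) / (a * Real.pi)) / 4

/-- `β = (2 - sin(2aπ)/(aπ)) / 4`. -/
def beta (a : ℝ) : ℝ := (2 - Real.sin (2 * a * Real.pi) / (a * Real.pi)) / 4

/-- `a` solves `sin(2aπ)/(2aπ) = (S(2L-1)-2)/(S(2L+1))`. -/
def IsTuned (S L : ℕ) (a : ℝ) : Prop :=
  Real.sin (2 * a * Real.pi) / (2 * a * Real.pi)
    = ((S : ℝ) * (2 * L - 1) - 2) / ((S : ℝ) * (2 * L + 1))

end VQE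

end

noncomputable section

namespace VQE

lemma exp_smul_conj (z : ℂ) (U V : Matrix (Fin 2) (Fin 2) ℂ) (h : U * V = 1) (h' : V * U = 1) :
    NormedSpace.exp (z • (U * !![1, 0; 0, -1] * V))
      = U * !![Complex.exp z, 0; 0, Complex.exp (-z)] * V := by
  have e1 : z • (U * !![1, 0; 0, -1] * V) = U * Matrix.diagonal ![z, -z] * V := by
    rw [← Matrix.smul_mul, ← Matrix.mul_smul]
    congr 2
    ext i j; fin_cases i <;> fin_cases j <;> simp
  have e2 : (!![Complex.exp z, 0; 0, Complex.exp (-z)] : Matrix (Fin 2) (Fin 2) ℂ)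
      = NormedSpace.exp (Matrix.diagonal ![z, -z]) := by
    rw [Matrix.exp_diagonal]
    ext i j; fin_cases i <;> fin_cases j <;> simp [Pi.coe_exp, Complex.exp_eq_exp_ℂ]
  rw [e1, e2]
  exact Matrix.exp_units_conj ⟨U, V, h, h'⟩ (Matrix.diagonal ![z, -z])

lemma rotX_eq (t : ℝ) : rotX t = !![(Real.cos (t / 2) : ℂ), -Complex.I * Real.sin (t / 2);
    -Complex.I * Real.sin (t / 2), Real.cos (t / 2)] := by
  have e : pauli 1 = !![1, 1; 1, -1] * !![1, 0; 0, -1] * !![1/2, 1/2; 1/2, -1/2] := by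
    ext i j; fin_cases i <;> fin_cases j <;> simp [pauli] <;> norm_num
  rw [rotX, rotation, e, exp_smul_conj]
  · rw [show -Complex.I * ((t : ℂ) / 2) = ((-(t / 2) : ℝ) : ℂ) * Complex.I by push_cast; ring,
      ← neg_mul, ← Complex.ofReal_neg]
    simp only [Complex.exp_mul_I, ← Complex.ofReal_cos, ← Complex.ofReal_sin, Real.cos_neg,
      Real.sin_neg]
    ext i j; fin_cases i <;> fin_cases j <;> simp <;> ring
  all_goals
    ext i j; fin_cases i <;> fin_cases j <;> simp <;> norm_num

lemma rotY_eq (t : ℝ) : rotY t = !![(Real.cos (t / 2) : ℂ), -Real.sin (t / 2);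
    Real.sin (t / 2), Real.cos (t / 2)] := by
  have e : pauli 2 = !![1, 1; Complex.I, -Complex.I] * !![1, 0; 0, -1]
      * !![1/2, -Complex.I/2; 1/2, Complex.I/2] := by
    ext i j; fin_cases i <;> fin_cases j <;> simp [pauli] <;> ring_nf
  rw [rotY, rotation, e, exp_smul_conj]
  · rw [show -Complex.I * ((t : ℂ) / 2) = ((-(t / 2) : ℝ) : ℂ) * Complex.I by push_cast; ring,
      ← neg_mul, ← Complex.ofReal_neg]
    simp only [Complex.exp_mul_I, ← Complex.ofReal_cos, ← Complex.ofReal_sin, Real.cos_neg,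
      Real.sin_neg]
    ext i j; fin_cases i <;> fin_cases j <;> simp <;> ring_nf <;> simp
  all_goals
    ext i j; fin_cases i <;> fin_cases j <;> simp <;> ring_nf <;> simp <;> norm_num

/-- Real `4 × 4` matrices acting on the Pauli basis as a rotation about the `X` axis (`b = 0`) or the
`Y` axis (`b = 1`), with fixed part `u` and rotating part `x`, `y`. -/
def bloch (b : Fin 2) (u x y : ℝ) : Fin 4 → Fin 4 → ℝ :=
  ![![![u, 0, 0, 0], ![0, u, 0, 0], ![0, 0, x, -y], ![0, 0, y, x]],
    ![![u, 0, 0, 0], ![0, x, 0, y], ![0, 0, u, 0], ![0, -y, 0, x]]] b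

lemma rotX_conj (t : ℝ) (p : Fin 4) : (rotX t).conjTranspose * pauli p * rotX t
    = ∑ q, ((bloch 0 1 (Real.cos t) (Real.sin t) p q : ℝ) : ℂ) • pauli q := by
  have hc : Real.cos t = Real.cos (t/2) ^ 2 - Real.sin (t/2) ^ 2 := by
    rw [← Real.cos_two_mul']; ring_nf
  have hs : Real.sin t = 2 * Real.sin (t/2) * Real.cos (t/2) := by
    rw [← Real.sin_two_mul]; ring_nf
  have h1 : (Real.cos (t/2) : ℂ) ^ 2 = 1 - (Real.sin (t/2) : ℂ) ^ 2 := by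
    have := Real.cos_sq' (t/2); exact_mod_cast this
  rw [rotX_eq, hc, hs]
  generalize Real.cos (t/2) = c at *
  generalize Real.sin (t/2) = s at *
  ext i j
  fin_cases p <;> fin_cases i <;> fin_cases j <;>
    simp [bloch, pauli, Matrix.mul_apply, Fin.sum_univ_succ] <;> ring_nf <;> simp [h1] <;> ring
lemma rotY_conj (t : ℝ) (p : Fin 4) : (rotY t).conjTranspose * pauli p * rotY t
    = ∑ q, ((bloch 1 1 (Real.cos t) (Real.sin t) p q : ℝ) : ℂ) • pauli q := by
  have hc : Real.cos t = Real.cos (t/2) ^ 2 - Real.sin (t/2) ^ 2 := by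
    rw [← Real.cos_two_mul']; ring_nf
  have hs : Real.sin t = 2 * Real.sin (t/2) * Real.cos (t/2) := by
    rw [← Real.sin_two_mul]; ring_nf
  have h1 : (Real.cos (t/2) : ℂ) ^ 2 = 1 - (Real.sin (t/2) : ℂ) ^ 2 := by
    have := Real.cos_sq' (t/2); exact_mod_cast this
  rw [rotY_eq, hc, hs]
  generalize Real.cos (t/2) = c at *
  generalize Real.sin (t/2) = s at *
  ext i j
  fin_cases p <;> fin_cases i <;> fin_cases j <;>
    simp [bloch, pauli, Matrix.mul_apply, Fin.sum_univ_succ] <;> ring_nf <;> simp [h1] <;> ring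

section Tensor
variable {N : ℕ}

lemma tensor_mul (A B : Fin N → Matrix (Fin 2) (Fin 2) ℂ) :
    tensor A * tensor B = tensor fun n => A n * B n := by
  ext x y
  simp only [tensor, Matrix.mul_apply, Matrix.of_apply, ← Finset.prod_mul_distrib]
  rw [Finset.prod_univ_sum, Fintype.piFinset_univ]

lemma tensor_conjTranspose (A : Fin N → Matrix (Fin 2) (Fin 2) ℂ) :
    (tensor A).conjTranspose = tensor fun n => (A n).conjTranspose := by
  ext x y
  simp [tensor, Matrix.conjTranspose_apply, star_prod]

lemma tensor_sum_smul (c : Fin N → Fin 4 → ℝ) :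
    tensor (fun n => ∑ q, (c n q : ℂ) • pauli q)
      = ∑ Q : Fin N → Fin 4, ((∏ n, c n (Q n) : ℝ) : ℂ) • pauliString Q := by
  ext x y
  simp only [tensor, Matrix.of_apply, Matrix.sum_apply, Matrix.smul_apply, pauliString,
    Complex.ofReal_prod, smul_eq_mul, ← Finset.prod_mul_distrib]
  rw [Finset.prod_univ_sum, Fintype.piFinset_univ]

/-- Whether a Pauli label is `X` or `Y`. -/
def flips (p : Fin 4) : Prop := p = 1 ∨ p = 2

instance : DecidablePred flips := fun p => inferInstanceAs (Decidable (p = 1 ∨ p = 2))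

/-- The Pauli string obtained, up to sign, by conjugating with a controlled-`Z` gate. -/
def czLabel (p : QubitPair N) (R : Fin N → Fin 4) : Fin N → Fin 4 := fun n =>
  if (n = p.1.1 ∧ flips (R p.1.2)) ∨ (n = p.1.2 ∧ flips (R p.1.1)) then (R n).rev else R n

/-- The sign produced by conjugating a Pauli string with a controlled-`Z` gate. -/
def czSign (p : QubitPair N) (R : Fin N → Fin 4) : ℝ :=
  if flips (R p.1.1) ∧ flips (R p.1.2) ∧ R p.1.1 ≠ R p.1.2 then -1 else 1

/-- The two-qubit identity behind `czGate_conj`. -/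
lemma cz_pauli_two (r s : Fin 4) (x y z w : Fin 2) :
    (if x = 1 ∧ z = 1 then (-1 : ℂ) else 1) * (pauli r x y * pauli s z w) *
      (if y = 1 ∧ w = 1 then -1 else 1)
    = (if flips r ∧ flips s ∧ r ≠ s then -1 else 1) *
      (pauli (if flips s then r.rev else r) x y * pauli (if flips r then s.rev else s) z w) := by
  fin_cases r <;> fin_cases s <;> fin_cases x <;> fin_cases y <;> fin_cases z <;> fin_cases w <;>
    simp [pauli, flips, Fin.rev]

lemma czGate_conj (p : QubitPair N) (R : Fin N → Fin 4) :
    (czGate p).conjTranspose * pauliString R * czGate p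
      = (czSign p R : ℂ) • pauliString (czLabel p R) := by
  obtain ⟨⟨a, b⟩, hab⟩ := p
  simp only at hab
  ext x y
  have hd : (czGate ⟨(a, b), hab⟩).conjTranspose = czGate ⟨(a, b), hab⟩ := by
    rw [czGate, Matrix.diagonal_conjTranspose]
    congr 1; ext x; simp only [Pi.star_apply]; split_ifs <;> simp
  rw [hd, czGate, Matrix.mul_diagonal, Matrix.diagonal_mul]
  simp only [Matrix.smul_apply, smul_eq_mul, pauliString, tensor, Matrix.of_apply]
  have split : ∀ f : Fin N → ℂ, ∏ n, f n = (f a * f b) * ∏ n ∈ (Finset.univ.erase a).erase b, f n := by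
    intro f
    rw [mul_assoc, Finset.mul_prod_erase _ _ (by simp [hab.symm]), Finset.mul_prod_erase _ _ (by simp)]
  rw [split, split]
  have hrest : ∏ n ∈ (Finset.univ.erase a).erase b, pauli (czLabel ⟨(a, b), hab⟩ R n) (x n) (y n)
      = ∏ n ∈ (Finset.univ.erase a).erase b, pauli (R n) (x n) (y n) := by
    refine Finset.prod_congr rfl fun n hn => ?_
    simp only [Finset.mem_erase, Finset.mem_univ, and_true] at hn
    simp [czLabel, hn.1, hn.2]
  have h2 := cz_pauli_two (R a) (R b) (x a) (y a) (x b) (y b)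
  have ea : czLabel ⟨(a, b), hab⟩ R a = if flips (R b) then (R a).rev else R a := by
    simp [czLabel, hab]
  have eb : czLabel ⟨(a, b), hab⟩ R b = if flips (R a) then (R b).rev else R b := by
    simp [czLabel, hab.symm]
  rw [hrest, ea, eb]
  have es : (czSign ⟨(a, b), hab⟩ R : ℂ)
      = if flips (R a) ∧ flips (R b) ∧ R a ≠ R b then -1 else 1 := by
    simp only [czSign]; split_ifs <;> simp
  rw [es]
  linear_combination (∏ n ∈ (Finset.univ.erase a).erase b, pauli (R n) (x n) (y n)) * h2

/-- The Pauli string obtained, up to sign, by conjugating with an entanglement layer. -/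
def layerLabel : List (QubitPair N) → (Fin N → Fin 4) → Fin N → Fin 4
  | [], R => R
  | p :: E, R => layerLabel E (czLabel p R)

/-- The sign produced by conjugating a Pauli string with an entanglement layer. -/
def layerSign : List (QubitPair N) → (Fin N → Fin 4) → ℝ
  | [], _ => 1
  | p :: E, R => czSign p R * layerSign E (czLabel p R)

lemma czLayer_conj (E : List (QubitPair N)) (R : Fin N → Fin 4) :
    (czLayer E).conjTranspose * pauliString R * czLayer E
      = (layerSign E R : ℂ) • pauliString (layerLabel E R) := by
  induction E generalizing R with
  | nil => simp [czLayer, layerSign, layerLabel]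
  | cons p E ih =>
    have : czLayer (p :: E) = czGate p * czLayer E := by simp [czLayer]
    rw [this, Matrix.conjTranspose_mul, layerSign, layerLabel]
    calc _ = (czLayer E).conjTranspose * ((czGate p).conjTranspose * pauliString R * czGate p)
          * czLayer E := by simp only [Matrix.mul_assoc]
      _ = _ := by
        rw [czGate_conj, Matrix.mul_smul, Matrix.smul_mul, ih, smul_smul, Complex.ofReal_mul]

/-- The expectation values of the Pauli strings after `k` blocks, where conjugating with the
rotation `(l, b, n)` acts on the Pauli basis as the matrix `g l b n`. -/
def expval (E : ℕ → List (QubitPair N)) (g : ℕ → Fin 2 → Fin N → Fin 4 → Fin 4 → ℝ) :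
    ℕ → (Fin N → Fin 4) → ℝ
  | 0, P => if ∃ n, flips (P n) then 0 else 1
  | k + 1, P => ∑ Q : Fin N → Fin 4, ∑ R : Fin N → Fin 4,
      ((∏ n, g k 1 n (P n) (Q n)) * ∏ n, g k 0 n (Q n) (R n)) *
        (layerSign (E k) R * expval E g k (layerLabel (E k) R))

/-- The first `k` blocks of the ansatz. -/
def partialAnsatz (E : ℕ → List (QubitPair N)) (θ : ℕ → Fin 2 → Fin N → ℝ) : ℕ → Operator N
  | 0 => 1
  | k + 1 => tensor (fun j => rotY (θ k 1 j)) * tensor (fun j => rotX (θ k 0 j)) * czLayer (E k)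
      * partialAnsatz E θ k

/-- The action of a rotation by the angle `t` on the Pauli basis. -/
def blochRot (b : Fin 2) (t : ℝ) : Fin 4 → Fin 4 → ℝ := bloch b 1 (Real.cos t) (Real.sin t)

lemma tensor_rot_conj (R : ℝ → Matrix (Fin 2) (Fin 2) ℂ) (b : Fin 2)
    (hR : ∀ t p, (R t).conjTranspose * pauli p * R t = ∑ q, ((blochRot b t p q : ℝ) : ℂ) • pauli q)
    (t : Fin N → ℝ) (P : Fin N → Fin 4) :
    (tensor fun j => R (t j)).conjTranspose * pauliString P * (tensor fun j => R (t j))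
      = ∑ Q : Fin N → Fin 4, ((∏ n, blochRot b (t n) (P n) (Q n) : ℝ) : ℂ) • pauliString Q := by
  rw [tensor_conjTranspose, pauliString, tensor_mul, tensor_mul]
  simp only [hR, tensor_sum_smul fun n => blochRot b (t n) (P n)]

lemma trace_pauliString_zeroState (P : Fin N → Fin 4) :
    (pauliString P * zeroState N).trace = ((if ∃ n, flips (P n) then 0 else 1 : ℝ) : ℂ) := by
  rw [zeroState, Matrix.trace_mul_single, MulOpposite.op_one, one_smul]
  simp only [pauliString, tensor, Matrix.of_apply]
  split_ifs with h
  · obtain ⟨n, hn⟩ := h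
    rw [Complex.ofReal_zero]
    refine Finset.prod_eq_zero (Finset.mem_univ n) ?_
    rcases hn with hn | hn <;> simp [hn, pauli]
  · push Not at h
    rw [Complex.ofReal_one]
    refine Finset.prod_eq_one fun n _ => ?_
    have := h n
    revert this
    generalize P n = p
    fin_cases p <;> simp [flips, pauli]

lemma trace_partialAnsatz (E : ℕ → List (QubitPair N)) (θ : ℕ → Fin 2 → Fin N → ℝ) (k : ℕ)
    (P : Fin N → Fin 4) :
    (pauliString P * partialAnsatz E θ k * zeroState N * (partialAnsatz E θ k).conjTranspose).trace
      = (expval E (fun l b n => blochRot b (θ l b n)) k P : ℂ) := by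
  induction k generalizing P with
  | zero => simp [partialAnsatz, expval, trace_pauliString_zeroState]
  | succ k ih =>
    set A := partialAnsatz E θ k
    set TY := tensor (fun j => rotY (θ k 1 j)) with hTY
    set TX := tensor (fun j => rotX (θ k 0 j)) with hTX
    set Z := czLayer (E k) with hZ
    have e : (pauliString P * partialAnsatz E θ (k + 1) * zeroState N
        * (partialAnsatz E θ (k + 1)).conjTranspose).trace
        = ((Z.conjTranspose * (TX.conjTranspose * (TY.conjTranspose * pauliString P * TY) * TX) * Z)
          * (A * zeroState N * A.conjTranspose)).trace := by
      simp only [partialAnsatz, Matrix.conjTranspose_mul]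
      have : pauliString P * (TY * TX * Z * A) * zeroState N
          * (A.conjTranspose * (Z.conjTranspose * (TX.conjTranspose * TY.conjTranspose)))
          = (pauliString P * TY * TX * Z * A * zeroState N * A.conjTranspose) *
            (Z.conjTranspose * TX.conjTranspose * TY.conjTranspose) := by
        simp only [Matrix.mul_assoc]
      rw [this, Matrix.trace_mul_comm]
      simp only [Matrix.mul_assoc]
    rw [e, hTY, tensor_rot_conj rotY 1 rotY_conj]
    simp only [Matrix.mul_sum, Matrix.sum_mul, Matrix.mul_smul, Matrix.smul_mul, hTX,
      tensor_rot_conj rotX 0 rotX_conj, hZ, czLayer_conj, Matrix.trace_sum, Matrix.trace_smul]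
    simp only [← Matrix.mul_assoc, A, ih, expval, smul_eq_mul]
    push_cast
    refine Finset.sum_congr rfl fun Q _ => ?_
    simp only [Finset.mul_sum, mul_assoc]

end Tensor

section Circuit
variable {L N : ℕ}

/-- The angles, indexed by natural numbers. -/
def angles (θ : ParamIndex L N → ℝ) (l : ℕ) (b : Fin 2) (n : Fin N) : ℝ :=
  if h : l < L then θ (⟨l, h⟩, b, n) else 0

/-- The entanglement layers, indexed by natural numbers. -/
def layers (E : Fin L → List (QubitPair N)) (l : ℕ) : List (QubitPair N) :=
  if h : l < L then E ⟨l, h⟩ else []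

lemma ofFn_reverse_prod {M : Type*} [Monoid M] (f : ℕ → M) (A : ℕ → M) (h0 : A 0 = 1)
    (hs : ∀ k, A (k + 1) = f k * A k) (L : ℕ) :
    (List.ofFn fun l : Fin L => f l).reverse.prod = A L := by
  induction L with
  | zero => simp [h0]
  | succ L ih => rw [List.ofFn_succ_last, List.reverse_append, hs, ← ih]; simp

lemma ansatz_eq (E : Fin L → List (QubitPair N)) (θ : Params L N) :
    ansatz E θ = partialAnsatz (layers E) (angles θ) L := by
  rw [ansatz, ← ofFn_reverse_prod (fun k => tensor (fun j => rotY (angles θ k 1 j)) *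
    tensor (fun j => rotX (angles θ k 0 j)) * czLayer (layers E k))
    (partialAnsatz (layers E) (angles θ)) rfl (fun _ => rfl)]
  simp [block, angles, layers]

lemma cost_eq (𝒩 : Finset (Fin N → Fin 4)) (E : Fin L → List (QubitPair N)) (θ : Params L N) :
    cost 𝒩 E θ = ∑ P ∈ 𝒩, expval (layers E) (fun l b n => blochRot b (angles θ l b n)) L P := by
  have : (cost 𝒩 E θ : ℂ) = ((∑ P ∈ 𝒩,
      expval (layers E) (fun l b n => blochRot b (angles θ l b n)) L P : ℝ) : ℂ) := by
    rw [ofReal_cost, costTrace, hamiltonian, ansatz_eq, Complex.ofReal_sum]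
    simp only [Matrix.sum_mul, Matrix.trace_sum, trace_partialAnsatz]
  exact_mod_cast this

end Circuit

section Calculus
variable {L N : ℕ}

/-- The derivative of `blochRot`. -/
def blochDeriv (b : Fin 2) (t : ℝ) : Fin 4 → Fin 4 → ℝ := bloch b 0 (-Real.sin t) (Real.cos t)

lemma hasDerivAt_blochRot (b : Fin 2) (t : ℝ) (p q : Fin 4) :
    HasDerivAt (fun t => blochRot b t p q) (blochDeriv b t p q) t := by
  have hs := Real.hasDerivAt_sin t
  have hc := Real.hasDerivAt_cos t
  have hn : HasDerivAt (fun t => -Real.sin t) (-Real.cos t) t := hs.neg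
  fin_cases b <;> fin_cases p <;> fin_cases q <;>
    simp [blochRot, blochDeriv, bloch, hasDerivAt_const, hs, hc, hn]

lemma continuous_blochRot (b : Fin 2) (p q : Fin 4) : Continuous fun t => blochRot b t p q :=
  continuous_iff_continuousAt.2 fun t => (hasDerivAt_blochRot b t p q).continuousAt

lemma continuous_blochDeriv (b : Fin 2) (p q : Fin 4) : Continuous fun t => blochDeriv b t p q := by
  fin_cases b <;> fin_cases p <;> fin_cases q <;> simp [blochDeriv, bloch] <;> fun_prop

lemma expval_congr (E : ℕ → List (QubitPair N)) {g g' : ℕ → Fin 2 → Fin N → Fin 4 → Fin 4 → ℝ}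
    {k : ℕ} (h : ∀ l < k, g l = g' l) (P : Fin N → Fin 4) : expval E g k P = expval E g' k P := by
  induction k generalizing P with
  | zero => rfl
  | succ k ih =>
    simp only [expval, h k k.lt_succ_self, ih fun l hl => h l (hl.trans k.lt_succ_self)]

lemma continuous_expval {V : Type*} [TopologicalSpace V] (E : ℕ → List (QubitPair N))
    {g : V → ℕ → Fin 2 → Fin N → Fin 4 → Fin 4 → ℝ}
    (h : ∀ l b n p q, Continuous fun v => g v l b n p q) (k : ℕ) (P : Fin N → Fin 4) :
    Continuous fun v => expval E (g v) k P := by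
  induction k generalizing P with
  | zero => exact continuous_const
  | succ k ih =>
    refine continuous_finsetSum _ fun Q _ => continuous_finsetSum _ fun R _ => ?_
    exact ((continuous_finsetProd _ fun n _ => h _ _ _ _ _).mul
      (continuous_finsetProd _ fun n _ => h _ _ _ _ _)).mul (continuous_const.mul (ih _))

lemma differentiable_expval {V : Type*} [NormedAddCommGroup V] [NormedSpace ℝ V]
    (E : ℕ → List (QubitPair N)) {g : V → ℕ → Fin 2 → Fin N → Fin 4 → Fin 4 → ℝ}
    (h : ∀ l b n p q, Differentiable ℝ fun v => g v l b n p q) (k : ℕ) (P : Fin N → Fin 4) :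
    Differentiable ℝ fun v => expval E (g v) k P := by
  induction k generalizing P with
  | zero => exact differentiable_const _
  | succ k ih =>
    refine Differentiable.fun_sum fun Q _ => Differentiable.fun_sum fun R _ => ?_
    have hp : ∀ (b : Fin 2) (Q R : Fin N → Fin 4),
        Differentiable ℝ fun v => ∏ n, g v k b n (Q n) (R n) := fun b Q R v =>
      (HasFDerivAt.finsetProd fun n _ => (h k b n (Q n) (R n) v).hasFDerivAt).differentiableAt
    exact ((hp _ _ _).mul (hp _ _ _)).mul ((differentiable_const _).mul (ih _))

lemma hasDerivAt_prod_update {ι : Type*} [Fintype ι] [DecidableEq ι] (F : ι → ℝ) (i : ι)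
    {f : ℝ → ℝ} {f' s : ℝ} (hf : HasDerivAt f f' s) :
    HasDerivAt (fun t => ∏ n, Function.update F i (f t) n) (∏ n, Function.update F i f' n) s := by
  simp only [Finset.prod_update_of_mem (Finset.mem_univ i)]
  exact hf.mul_const _

/-- `g` with the matrix at `(l, b, n)` replaced by `G`. -/
def setMat (g : ℕ → Fin 2 → Fin N → Fin 4 → Fin 4 → ℝ) (l : ℕ) (b : Fin 2) (n : Fin N)
    (G : Fin 4 → Fin 4 → ℝ) : ℕ → Fin 2 → Fin N → Fin 4 → Fin 4 → ℝ :=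
  Function.update g l (Function.update (g l) b (Function.update (g l b) n G))

lemma prod_setMat_same (g : ℕ → Fin 2 → Fin N → Fin 4 → Fin 4 → ℝ) (l : ℕ) (b : Fin 2) (n : Fin N)
    (G : Fin 4 → Fin 4 → ℝ) (P Q : Fin N → Fin 4) :
    ∏ m, setMat g l b n G l b m (P m) (Q m)
      = ∏ m, Function.update (fun m => g l b m (P m) (Q m)) n (G (P n) (Q n)) m := by
  refine Finset.prod_congr rfl fun m _ => ?_
  simp only [setMat, Function.update_self]
  rcases eq_or_ne m n with rfl | h
  · simp
  · simp [h]

lemma setMat_of_ne_left {g : ℕ → Fin 2 → Fin N → Fin 4 → Fin 4 → ℝ} {l l' : ℕ} (b : Fin 2)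
    (n : Fin N) (G : Fin 4 → Fin 4 → ℝ) (h : l' ≠ l) : setMat g l b n G l' = g l' := by
  simp [setMat, h]

lemma setMat_of_ne {g : ℕ → Fin 2 → Fin N → Fin 4 → Fin 4 → ℝ} {l : ℕ} {b b' : Fin 2}
    (n : Fin N) (G : Fin 4 → Fin 4 → ℝ) (h : b' ≠ b) : setMat g l b n G l b' = g l b' := by
  simp [setMat, h]

lemma hasDerivAt_expval (E : ℕ → List (QubitPair N)) (g : ℕ → Fin 2 → Fin N → Fin 4 → Fin 4 → ℝ)
    (l : ℕ) (b : Fin 2) (n : Fin N) {G : ℝ → Fin 4 → Fin 4 → ℝ} {G' : Fin 4 → Fin 4 → ℝ} {s : ℝ}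
    (hG : ∀ p q, HasDerivAt (fun t => G t p q) (G' p q) s) {k : ℕ} (hk : l < k)
    (P : Fin N → Fin 4) :
    HasDerivAt (fun t => expval E (setMat g l b n (G t)) k P)
      (expval E (setMat g l b n G') k P) s := by
  induction k generalizing P with
  | zero => omega
  | succ k ih =>
    refine HasDerivAt.fun_sum fun Q _ => HasDerivAt.fun_sum fun R _ => ?_
    rcases (Nat.lt_succ_iff_lt_or_eq.1 hk) with h | rfl
    · simp only [setMat_of_ne_left b n _ h.ne']
      exact ((ih h _).const_mul _).const_mul _
    · have e : ∀ G₁ P, expval E (setMat g l b n G₁) l P = expval E g l P := fun G₁ P =>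
        expval_congr E (fun l' hl' => setMat_of_ne_left b n G₁ hl'.ne) P
      simp only [e]
      refine HasDerivAt.mul_const ?_ _
      have hb : b = 0 ∨ b = 1 := by fin_cases b <;> simp
      rcases hb with rfl | rfl
      · simp only [prod_setMat_same, setMat_of_ne n _ (one_ne_zero (α := Fin 2))]
        exact (hasDerivAt_prod_update _ n (hG _ _)).const_mul _
      · simp only [prod_setMat_same, setMat_of_ne n _ (zero_ne_one (α := Fin 2))]
        exact (hasDerivAt_prod_update _ n (hG _ _)).mul_const _

/-- The action on the Pauli basis of the rotations by the angle `t`, with the one labelled `q`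
differentiated. -/
def diffRot (q : ParamIndex L N) (l : ℕ) (b : Fin 2) (n : Fin N) (t : ℝ) : Fin 4 → Fin 4 → ℝ :=
  if l = q.1 ∧ b = q.2.1 ∧ n = q.2.2 then blochDeriv b t else blochRot b t

lemma continuous_diffRot (q : ParamIndex L N) (l : ℕ) (b : Fin 2) (n : Fin N) (p p' : Fin 4) :
    Continuous fun t => diffRot q l b n t p p' := by
  unfold diffRot
  split_ifs
  · exact continuous_blochDeriv b p p'
  · exact continuous_blochRot b p p'

/-- The partial derivatives of the expectation values. -/
def expvalDeriv (E : Fin L → List (QubitPair N)) (q : ParamIndex L N) (P : Fin N → Fin 4)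
    (θ : ParamIndex L N → ℝ) : ℝ :=
  expval (layers E) (fun l b n => diffRot q l b n (angles θ l b n)) L P

lemma continuous_angles (l : ℕ) (b : Fin 2) (n : Fin N) :
    Continuous fun θ : ParamIndex L N → ℝ => angles θ l b n := by
  unfold angles
  split_ifs <;> fun_prop

lemma continuous_expvalDeriv (E : Fin L → List (QubitPair N)) (q : ParamIndex L N)
    (P : Fin N → Fin 4) : Continuous (expvalDeriv E q P) :=
  continuous_expval _ (fun l b n p p' =>
    (continuous_diffRot q l b n p p').comp (continuous_angles l b n)) L P

lemma differentiable_expval_angles (E : Fin L → List (QubitPair N)) (P : Fin N → Fin 4) :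
    Differentiable ℝ fun θ : Params L N =>
      expval (layers E) (fun l b n => blochRot b (angles θ l b n)) L P := by
  refine differentiable_expval _ (fun l b n p q => ?_) L P
  refine Differentiable.comp (g := fun t => blochRot b t p q)
    (fun t => (hasDerivAt_blochRot b t p q).differentiableAt) ?_
  unfold angles
  split_ifs <;> fun_prop

lemma differentiable_cost (𝒩 : Finset (Fin N → Fin 4)) (E : Fin L → List (QubitPair N)) :
    Differentiable ℝ (cost 𝒩 E) := by
  rw [show cost 𝒩 E = _ from funext (cost_eq 𝒩 E)]
  exact Differentiable.fun_sum fun P _ => differentiable_expval_angles E P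

lemma hasDerivAt_cost_line (𝒩 : Finset (Fin N → Fin 4)) (E : Fin L → List (QubitPair N))
    (θ : Params L N) (q : ParamIndex L N) :
    HasDerivAt (fun s : ℝ => cost 𝒩 E (θ + s • EuclideanSpace.single q 1))
      (∑ P ∈ 𝒩, expvalDeriv E q P θ) 0 := by
  obtain ⟨l, b, n⟩ := q
  simp only [cost_eq]
  refine HasDerivAt.fun_sum fun P _ => ?_
  have e1 : ∀ s : ℝ, (fun l' b' n' => blochRot b'
        (angles (θ + s • EuclideanSpace.single (l, b, n) (1 : ℝ) : Params L N) l' b' n'))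
      = setMat (fun l b n => blochRot b (angles θ l b n)) l b n (blochRot b (θ (l, b, n) + s)) := by
    intro s
    ext l' b' n' : 3
    simp only [setMat]
    by_cases hl : l' = l
    · subst hl
      by_cases hb : b' = b
      · subst hb
        by_cases hn : n' = n
        · subst hn; simp [angles]
        · simp [hn, angles]
      · simp [hb, angles]
    · have : ∀ h : l' < L, (⟨l', h⟩ : Fin L) ≠ l := fun h h' => hl (by rw [← h'])
      simp [hl, angles, this]
  have e2 : (fun l' b' n' => diffRot (l, b, n) l' b' n' (angles θ l' b' n'))
      = setMat (fun l b n => blochRot b (angles θ l b n)) l b n (blochDeriv b (θ (l, b, n))) := by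
    ext l' b' n' : 3
    simp only [setMat, diffRot]
    by_cases hl : l' = l
    · subst hl
      by_cases hb : b' = b
      · subst hb
        by_cases hn : n' = n
        · subst hn; simp [angles]
        · simp [hn]
      · simp [hb]
    · simp [hl]
  simp only [e1, expvalDeriv, e2]
  refine hasDerivAt_expval _ _ l b n (fun p p' => ?_) l.2 P
  have := hasDerivAt_blochRot b (θ (l, b, n) + 0) p p'
  rw [add_zero] at this
  exact HasDerivAt.comp_const_add (θ (l, b, n)) 0 (by simpa using this)

lemma gradSq_eq (𝒩 : Finset (Fin N → Fin 4)) (E : Fin L → List (QubitPair N))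
    (θ : ParamIndex L N → ℝ) :
    gradSq 𝒩 E θ = ∑ q, (∑ P ∈ 𝒩, expvalDeriv E q P θ) ^ 2 := by
  rw [gradSq, EuclideanSpace.real_norm_sq_eq]
  refine Finset.sum_congr rfl fun q _ => ?_
  congr 1
  have hd := (differentiable_cost 𝒩 E (WithLp.toLp 2 θ)).hasGradientAt.hasFDerivAt
  have h1 := hd.hasLineDerivAt (EuclideanSpace.single q 1)
  have h2 := hasDerivAt_cost_line 𝒩 E (WithLp.toLp 2 θ) q
  have := HasDerivAt.unique h1 h2
  rw [WithLp.ofLp_toLp] at this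
  rw [← this, InnerProductSpace.toDual_apply_apply]
  simp [-inner_gradient_left, EuclideanSpace.inner_single_right]

lemma continuous_gradSq (𝒩 : Finset (Fin N → Fin 4)) (E : Fin L → List (QubitPair N)) :
    Continuous (gradSq 𝒩 E) := by
  rw [show gradSq 𝒩 E = _ from funext (gradSq_eq 𝒩 E)]
  exact continuous_finsetSum _ fun q _ =>
    (continuous_finsetSum _ fun P _ => continuous_expvalDeriv E q P).pow 2

end Calculus

section Law

/-- The uniform distribution on `[-aπ, aπ]`. -/
def angleLaw (a : ℝ) : Measure ℝ := cond volume (Set.Icc (-(a * Real.pi)) (a * Real.pi))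

variable {a : ℝ}

lemma isProbabilityMeasure_angleLaw (ha : 0 < a) : IsProbabilityMeasure (angleLaw a) := by
  refine cond_isProbabilityMeasure_of_finite ?_ (by simp)
  rw [Real.volume_Icc]
  have := mul_pos ha Real.pi_pos
  simp only [ne_eq, ENNReal.ofReal_eq_zero, not_le]
  linarith

lemma integral_angleLaw (ha : 0 < a) (f : ℝ → ℝ) :
    ∫ t, f t ∂(angleLaw a) = (2 * (a * Real.pi))⁻¹ * ∫ t in (-(a * Real.pi))..(a * Real.pi), f t := by
  have hA := mul_pos ha Real.pi_pos
  rw [angleLaw, ProbabilityTheory.cond, integral_smul_measure, Real.volume_Icc,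
    intervalIntegral.integral_of_le (by linarith), integral_Icc_eq_integral_Ioc, smul_eq_mul,
    ENNReal.toReal_inv, ENNReal.toReal_ofReal (by linarith)]
  ring_nf

lemma paramLaw_eq (L N : ℕ) (a : ℝ) : paramLaw L N a = Measure.pi fun _ => angleLaw a := rfl

lemma integrable_paramLaw {L N : ℕ} (ha : 0 < a) {F : (ParamIndex L N → ℝ) → ℝ}
    (hF : Continuous F) : Integrable F (paramLaw L N a) := by
  have := isProbabilityMeasure_angleLaw ha
  rw [paramLaw_eq]
  set K : Set (ParamIndex L N → ℝ) :=
    Set.univ.pi fun _ => Set.Icc (-(a * Real.pi)) (a * Real.pi) with hK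
  have hKc : IsCompact K := isCompact_univ_pi fun _ => isCompact_Icc
  obtain ⟨C, hC⟩ := hKc.exists_bound_of_continuousOn hF.continuousOn
  refine Integrable.of_bound hF.aestronglyMeasurable C ?_
  have : ∀ᵐ θ ∂(Measure.pi fun _ : ParamIndex L N => angleLaw a), ∀ q, θ q ∈
      Set.Icc (-(a * Real.pi)) (a * Real.pi) := by
    rw [ae_all_iff]
    intro q
    exact (measurePreserving_eval (fun _ : ParamIndex L N => angleLaw a) q).quasiMeasurePreserving.ae
      (ae_cond_mem measurableSet_Icc)
  filter_upwards [this] with θ hθ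
  exact hC θ fun q _ => hθ q

lemma integrable_angleLaw (ha : 0 < a) {f : ℝ → ℝ} (hf : Continuous f) :
    Integrable f (angleLaw a) := by
  have := isProbabilityMeasure_angleLaw ha
  obtain ⟨C, hC⟩ := (isCompact_Icc (a := -(a * Real.pi)) (b := a * Real.pi)).exists_bound_of_continuousOn
    hf.continuousOn
  refine Integrable.of_bound hf.aestronglyMeasurable C ?_
  filter_upwards [ae_cond_mem (μ := volume) measurableSet_Icc] with t ht using hC t ht

lemma integral_sin_angleLaw (ha : 0 < a) : ∫ t, Real.sin t ∂(angleLaw a) = 0 := by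
  rw [integral_angleLaw ha, integral_sin, Real.cos_neg]; simp

lemma integral_cos_mul_sin_angleLaw (ha : 0 < a) :
    ∫ t, Real.cos t * Real.sin t ∂(angleLaw a) = 0 := by
  simp_rw [mul_comm (Real.cos _)]
  rw [integral_angleLaw ha, integral_sin_mul_cos₁, Real.sin_neg]; simp

lemma integral_cos_sq_angleLaw (ha : 0 < a) : ∫ t, Real.cos t ^ 2 ∂(angleLaw a) = alpha a := by
  have hA := mul_pos ha Real.pi_pos
  rw [integral_angleLaw ha, integral_cos_sq, Real.cos_neg, Real.sin_neg, alpha,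
    show 2 * a * Real.pi = 2 * (a * Real.pi) by ring, Real.sin_two_mul]
  field_simp
  ring

lemma integral_sin_sq_angleLaw (ha : 0 < a) : ∫ t, Real.sin t ^ 2 ∂(angleLaw a) = beta a := by
  have hA := mul_pos ha Real.pi_pos
  rw [integral_angleLaw ha, integral_sin_sq, Real.cos_neg, Real.sin_neg, beta,
    show 2 * a * Real.pi = 2 * (a * Real.pi) by ring, Real.sin_two_mul]
  field_simp
  ring

lemma alpha_add_beta (a : ℝ) : alpha a + beta a = 1 := by
  rw [alpha, beta]; ring

lemma alpha_nonneg (ha : 0 < a) : 0 ≤ alpha a := by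
  rw [← integral_cos_sq_angleLaw ha]; exact integral_nonneg fun t => sq_nonneg _

lemma beta_nonneg (ha : 0 < a) : 0 ≤ beta a := by
  rw [← integral_sin_sq_angleLaw ha]; exact integral_nonneg fun t => sq_nonneg _

end Law

section TwoCopy
variable {L N : ℕ}

/-- The second moments of `expval` with independent random matrices whose entries have the second
moments `m`. -/
def twoCopy (E : ℕ → List (QubitPair N))
    (m : ℕ → Fin 2 → Fin N → Fin 4 → Fin 4 → Fin 4 → Fin 4 → ℝ) :
    ℕ → (Fin N → Fin 4) → (Fin N → Fin 4) → ℝ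
  | 0, P, P' => (if ∃ n, flips (P n) then 0 else 1) * if ∃ n, flips (P' n) then 0 else 1
  | k + 1, P, P' => ∑ x : (Fin N → Fin 4) × (Fin N → Fin 4), ∑ y : (Fin N → Fin 4) × (Fin N → Fin 4),
      ((∏ n, m k 1 n (P n) (P' n) (x.1 n) (y.1 n)) * ∏ n, m k 0 n (x.1 n) (y.1 n) (x.2 n) (y.2 n)) *
        ((layerSign (E k) x.2 * layerSign (E k) y.2) *
          twoCopy E m k (layerLabel (E k) x.2) (layerLabel (E k) y.2))

/-- The second moments of the entries of the random matrices `ρ l b n`. -/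
def moments (a : ℝ) (ρ : ℕ → Fin 2 → Fin N → ℝ → Fin 4 → Fin 4 → ℝ) (l : ℕ) (b : Fin 2)
    (n : Fin N) (p p' q q' : Fin 4) : ℝ :=
  ∫ t, ρ l b n t p q * ρ l b n t p' q' ∂(angleLaw a)

lemma prod_layer (l : Fin L) (s : Fin 2 → Fin N → ℝ) :
    ∏ q : ParamIndex L N, (if q.1 = l then s q.2.1 q.2.2 else 1) = (∏ n, s 1 n) * ∏ n, s 0 n := by
  rw [Fintype.prod_prod_type, Finset.prod_eq_single l]
  · simp [Fintype.prod_prod_type, mul_comm]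
  · intro l' _ h; simp [h]
  · simp

lemma integral_expval_mul_expval {a : ℝ} (ha : 0 < a) (E : ℕ → List (QubitPair N))
    (ρ : ℕ → Fin 2 → Fin N → ℝ → Fin 4 → Fin 4 → ℝ)
    (hρ : ∀ l b n p q, Continuous fun t => ρ l b n t p q) {k : ℕ} (hk : k ≤ L)
    (P P' : Fin N → Fin 4) (h : ParamIndex L N → ℝ → ℝ) (hc : ∀ q, Continuous (h q))
    (h1 : ∀ q : ParamIndex L N, (q.1 : ℕ) < k → h q = 1) :
    ∫ θ, expval E (fun l b n => ρ l b n (angles θ l b n)) k P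
        * expval E (fun l b n => ρ l b n (angles θ l b n)) k P' * ∏ q, h q (θ q) ∂(paramLaw L N a)
      = twoCopy E (moments a ρ) k P P' * ∏ q, ∫ t, h q t ∂(angleLaw a) := by
  have := isProbabilityMeasure_angleLaw ha
  induction k generalizing P P' h with
  | zero =>
    simp only [expval, twoCopy]
    rw [integral_const_mul, paramLaw_eq, integral_fintype_prod_eq_prod]
  | succ k ih =>
    set v : (ParamIndex L N → ℝ) → (Fin N → Fin 4) → ℝ :=
      fun θ => expval E (fun l b n => ρ l b n (angles θ l b n)) k with hv
    have hvc : ∀ P, Continuous fun θ => v θ P := fun P =>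
      continuous_expval E (fun l b n p q => (hρ l b n p q).comp (continuous_angles l b n)) k P
    let κ : Fin L := ⟨k, hk⟩
    let w : (Fin N → Fin 4) → (Fin N → Fin 4) × (Fin N → Fin 4) → Fin 2 → Fin N → ℝ → ℝ :=
      fun P x b n t => if b = 1 then ρ k b n t (P n) (x.1 n) else ρ k b n t (x.1 n) (x.2 n)
    have hwc : ∀ P x b n, Continuous (w P x b n) := by
      intro P x b n
      simp only [w]
      split_ifs <;> apply hρ
    let h' : (Fin N → Fin 4) × (Fin N → Fin 4) → (Fin N → Fin 4) × (Fin N → Fin 4) →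
        ParamIndex L N → ℝ → ℝ := fun x y q t => h q t *
      if q.1 = κ then w P x q.2.1 q.2.2 t * w P' y q.2.1 q.2.2 t else 1
    have hc' : ∀ x y q, Continuous (h' x y q) := by
      intro x y q
      simp only [h']
      split_ifs
      · exact (hc q).mul ((hwc _ _ _ _).mul (hwc _ _ _ _))
      · exact (hc q).mul continuous_const
    have h1' : ∀ x y (q : ParamIndex L N), (q.1 : ℕ) < k → h' x y q = 1 := by
      intro x y q hq
      have : q.1 ≠ κ := fun e => by simp [e, κ] at hq
      ext t
      simp [h', this, h1 q (by omega)]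
    have expand : ∀ θ P, expval E (fun l b n => ρ l b n (angles θ l b n)) (k + 1) P
        = ∑ x, ((∏ n, w P x 1 n (θ (κ, 1, n))) * ∏ n, w P x 0 n (θ (κ, 0, n))) *
          (layerSign (E k) x.2 * v θ (layerLabel (E k) x.2)) := by
      intro θ P
      rw [expval, ← Fintype.sum_prod_type']
      have hk' : k < L := hk
      simp [angles, hk', w, κ, hv]
    have integrand : ∀ θ, expval E (fun l b n => ρ l b n (angles θ l b n)) (k + 1) P
        * expval E (fun l b n => ρ l b n (angles θ l b n)) (k + 1) P' * ∏ q, h q (θ q)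
        = ∑ x, ∑ y, (layerSign (E k) x.2 * layerSign (E k) y.2) *
          (v θ (layerLabel (E k) x.2) * v θ (layerLabel (E k) y.2) * ∏ q, h' x y q (θ q)) := by
      intro θ
      rw [expand, expand, Finset.sum_mul_sum, Finset.sum_mul]
      refine Finset.sum_congr rfl fun x _ => ?_
      rw [Finset.sum_mul]
      refine Finset.sum_congr rfl fun y _ => ?_
      have := prod_layer κ fun b n => w P x b n (θ (κ, b, n)) * w P' y b n (θ (κ, b, n))
      have e : ∏ q, h' x y q (θ q) = (∏ q, h q (θ q)) * ∏ q : ParamIndex L N,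
          (if q.1 = κ then w P x q.2.1 q.2.2 (θ (κ, q.2.1, q.2.2)) *
            w P' y q.2.1 q.2.2 (θ (κ, q.2.1, q.2.2)) else 1) := by
        rw [← Finset.prod_mul_distrib]
        refine Finset.prod_congr rfl fun q _ => ?_
        simp only [h']
        split_ifs with hq
        · rw [← hq]
        · rfl
      rw [e, this, Finset.prod_mul_distrib, Finset.prod_mul_distrib]
      ring
    have integrals : ∀ x y, ∏ q, ∫ t, h' x y q t ∂(angleLaw a)
        = (∏ q, ∫ t, h q t ∂(angleLaw a)) *
          ((∏ n, moments a ρ k 1 n (P n) (P' n) (x.1 n) (y.1 n)) *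
            ∏ n, moments a ρ k 0 n (x.1 n) (y.1 n) (x.2 n) (y.2 n)) := by
      intro x y
      have := prod_layer κ fun b n => ∫ t, w P x b n t * w P' y b n t ∂(angleLaw a)
      have e : (∏ n, moments a ρ k 1 n (P n) (P' n) (x.1 n) (y.1 n)) *
            ∏ n, moments a ρ k 0 n (x.1 n) (y.1 n) (x.2 n) (y.2 n)
          = (∏ n, ∫ t, w P x 1 n t * w P' y 1 n t ∂(angleLaw a)) *
            ∏ n, ∫ t, w P x 0 n t * w P' y 0 n t ∂(angleLaw a) := by
        simp [moments, w]
      rw [e, ← this, ← Finset.prod_mul_distrib]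
      refine Finset.prod_congr rfl fun q _ => ?_
      simp only [h']
      split_ifs with hq
      · have : h q = 1 := h1 q (by rw [hq]; exact k.lt_succ_self)
        simp [this]
      · simp
    simp_rw [integrand]
    rw [integral_finsetSum, twoCopy, Finset.sum_mul]
    · refine Finset.sum_congr rfl fun x _ => ?_
      rw [integral_finsetSum, Finset.sum_mul]
      · refine Finset.sum_congr rfl fun y _ => ?_
        rw [integral_const_mul, ih (Nat.le_of_succ_le hk) _ _ _ (hc' x y) (h1' x y), integrals]
        ring
      · intro y _
        refine integrable_paramLaw ha (continuous_const.mul (((hvc _).mul (hvc _)).mul ?_))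
        exact continuous_finsetProd _ fun q _ => (hc' x y q).comp (continuous_apply q)
    · intro x _
      refine integrable_paramLaw ha (continuous_finsetSum _ fun y _ =>
        continuous_const.mul (((hvc _).mul (hvc _)).mul ?_))
      exact continuous_finsetProd _ fun q _ => (hc' x y q).comp (continuous_apply q)

lemma integral_expvalDeriv_mul {a : ℝ} (ha : 0 < a) (E : Fin L → List (QubitPair N))
    (q : ParamIndex L N) (P P' : Fin N → Fin 4) :
    ∫ θ, expvalDeriv E q P θ * expvalDeriv E q P' θ ∂(paramLaw L N a)
      = twoCopy (layers E) (moments a (diffRot q)) L P P' := by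
  have := isProbabilityMeasure_angleLaw ha
  have := integral_expval_mul_expval (L := L) ha (layers E) (diffRot q) (continuous_diffRot q) le_rfl P P'
    (fun _ _ => 1) (fun _ => continuous_const) (fun _ _ => rfl)
  simpa [expvalDeriv] using this

lemma integral_gradSq {a : ℝ} (ha : 0 < a) (𝒩 : Finset (Fin N → Fin 4))
    (E : Fin L → List (QubitPair N)) :
    ∫ θ, gradSq 𝒩 E θ ∂(paramLaw L N a)
      = ∑ q : ParamIndex L N, ∑ P ∈ 𝒩, ∑ P' ∈ 𝒩, twoCopy (layers E) (moments a (diffRot q)) L P P' := by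
  simp_rw [gradSq_eq, sq, Finset.sum_mul_sum, ← integral_expvalDeriv_mul ha]
  have hc := fun q P => continuous_expvalDeriv E q P
  rw [integral_finsetSum]
  · refine Finset.sum_congr rfl fun q _ => ?_
    rw [integral_finsetSum]
    · refine Finset.sum_congr rfl fun P _ => ?_
      rw [integral_finsetSum]
      exact fun P' _ => integrable_paramLaw ha ((hc _ _).mul (hc _ _))
    · exact fun P _ => integrable_paramLaw ha
        (continuous_finsetSum _ fun P' _ => (hc _ _).mul (hc _ _))
  · exact fun q _ => integrable_paramLaw ha (continuous_finsetSum _ fun P _ =>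
      continuous_finsetSum _ fun P' _ => (hc _ _).mul (hc _ _))

end TwoCopy

section Site

/-- The second moments of the entries of `bloch b u x y` when `u y` and `x y` have mean zero. -/
def blochMoment (b : Fin 2) (uu ux xx yy : ℝ) (p p' q q' : Fin 4) : ℝ :=
  uu * (bloch b 1 0 0 p q * bloch b 1 0 0 p' q')
    + ux * (bloch b 1 0 0 p q * bloch b 0 1 0 p' q' + bloch b 0 1 0 p q * bloch b 1 0 0 p' q')
    + xx * (bloch b 0 1 0 p q * bloch b 0 1 0 p' q')
    + yy * (bloch b 0 0 1 p q * bloch b 0 0 1 p' q')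

lemma bloch_eq (b : Fin 2) (u x y : ℝ) (p q : Fin 4) :
    bloch b u x y p q = u * bloch b 1 0 0 p q + x * bloch b 0 1 0 p q + y * bloch b 0 0 1 p q := by
  fin_cases b <;> fin_cases p <;> fin_cases q <;> simp [bloch]

lemma integral_trig {a : ℝ} (ha : 0 < a) (c₀ c₁ c₂ c₃ c₄ c₅ : ℝ) :
    ∫ t, (c₀ + c₁ * Real.cos t + c₂ * Real.cos t ^ 2 + c₃ * Real.sin t ^ 2 + c₄ * Real.sin t
      + c₅ * (Real.cos t * Real.sin t)) ∂(angleLaw a)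
      = c₀ + c₁ * ∫ t, Real.cos t ∂(angleLaw a) + c₂ * alpha a + c₃ * beta a := by
  have := isProbabilityMeasure_angleLaw ha
  have hi : ∀ {f : ℝ → ℝ}, Continuous f → Integrable f (angleLaw a) := integrable_angleLaw ha
  rw [integral_add (hi (by fun_prop)) (hi (by fun_prop)),
    integral_add (hi (by fun_prop)) (hi (by fun_prop)),
    integral_add (hi (by fun_prop)) (hi (by fun_prop)),
    integral_add (hi (by fun_prop)) (hi (by fun_prop)),
    integral_add (hi (by fun_prop)) (hi (by fun_prop))]
  simp only [integral_const_mul, integral_sin_angleLaw ha, integral_cos_mul_sin_angleLaw ha,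
    integral_cos_sq_angleLaw ha, integral_sin_sq_angleLaw ha]
  simp

lemma integral_blochRot_mul {a : ℝ} (ha : 0 < a) (b : Fin 2) (p p' q q' : Fin 4) :
    ∫ t, blochRot b t p q * blochRot b t p' q' ∂(angleLaw a)
      = blochMoment b 1 (∫ t, Real.cos t ∂(angleLaw a)) (alpha a) (beta a) p p' q q' := by
  simp only [blochRot, blochMoment]
  simp_rw [bloch_eq b 1 (Real.cos _) (Real.sin _)]
  generalize bloch b 1 0 0 p q = A, bloch b 1 0 0 p' q' = A', bloch b 0 1 0 p q = B,
    bloch b 0 1 0 p' q' = B', bloch b 0 0 1 p q = C, bloch b 0 0 1 p' q' = C'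
  rw [integral_congr_ae (.of_forall fun t => show _ = (A * A') + (A * B' + B * A') * Real.cos t
    + (B * B') * Real.cos t ^ 2 + (C * C') * Real.sin t ^ 2 + (A * C' + C * A') * Real.sin t
    + (B * C' + C * B') * (Real.cos t * Real.sin t) by ring), integral_trig ha]
  ring

lemma integral_blochDeriv_mul {a : ℝ} (ha : 0 < a) (b : Fin 2) (p p' q q' : Fin 4) :
    ∫ t, blochDeriv b t p q * blochDeriv b t p' q' ∂(angleLaw a)
      = blochMoment b 0 0 (beta a) (alpha a) p p' q q' := by
  simp only [blochDeriv, blochMoment]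
  simp_rw [bloch_eq b 0 (-Real.sin _) (Real.cos _)]
  generalize bloch b 1 0 0 p q = A, bloch b 1 0 0 p' q' = A', bloch b 0 1 0 p q = B,
    bloch b 0 1 0 p' q' = B', bloch b 0 0 1 p q = C, bloch b 0 0 1 p' q' = C'
  rw [integral_congr_ae (.of_forall fun t => show _ = 0 + 0 * Real.cos t
    + (C * C') * Real.cos t ^ 2 + (B * B') * Real.sin t ^ 2 + 0 * Real.sin t
    + (-(B * C' + C * B')) * (Real.cos t * Real.sin t) by ring), integral_trig ha]
  ring

/-- The second moments of the action of `R_Y` followed by `R_X` on one qubit. -/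
def siteMoment (mY mX : Fin 4 → Fin 4 → Fin 4 → Fin 4 → ℝ) (p p' r r' : Fin 4) : ℝ :=
  ∑ q, ∑ q', mY p p' q q' * mX q q' r r'

/-- The labels agree or both belong to `{I, Z}`. -/
def Compatible (p p' : Fin 4) : Prop := p = p' ∨ (¬flips p ∧ ¬flips p')

instance (p p' : Fin 4) : Decidable (Compatible p p') :=
  inferInstanceAs (Decidable (p = p' ∨ (¬flips p ∧ ¬flips p')))

lemma siteMoment_nonneg {uu ux xx yy uu' ux' xx' yy' : ℝ} (h1 : 0 ≤ uu) (h2 : 0 ≤ xx) (h3 : 0 ≤ yy)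
    (h1' : 0 ≤ uu') (h2' : 0 ≤ xx') (h3' : 0 ≤ yy') (hu : 0 ≤ ux * ux') {p p' r r' : Fin 4}
    (hr : Compatible r r') :
    0 ≤ siteMoment (blochMoment 1 uu ux xx yy) (blochMoment 0 uu' ux' xx' yy') p p' r r' ∧
    (siteMoment (blochMoment 1 uu ux xx yy) (blochMoment 0 uu' ux' xx' yy') p p' r r' ≠ 0 →
      Compatible p p') := by
  by_cases hp : Compatible p p'
  · refine ⟨?_, fun _ => hp⟩
    revert hp hr
    fin_cases r <;> fin_cases r' <;> try exact fun h => absurd h (by decide)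
    all_goals fin_cases p <;> fin_cases p' <;> try exact fun _ h => absurd h (by decide)
    all_goals
      intro _ _
      simp [siteMoment, blochMoment, bloch, Fin.sum_univ_four]
      try first | positivity | exact hu
  · have : siteMoment (blochMoment 1 uu ux xx yy) (blochMoment 0 uu' ux' xx' yy') p p' r r' = 0 := by
      revert hp hr
      fin_cases r <;> fin_cases r' <;> try exact fun h => absurd h (by decide)
      all_goals fin_cases p <;> fin_cases p' <;> try exact fun _ h => absurd (by decide) h
      all_goals
        intro _ _
        simp [siteMoment, blochMoment, bloch, Fin.sum_univ_four]
    exact ⟨this.ge, fun h => absurd this h⟩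

lemma siteMoment_zero (uu ux xx yy uu' ux' xx' yy' : ℝ) :
    siteMoment (blochMoment 1 uu ux xx yy) (blochMoment 0 uu' ux' xx' yy') 0 0 0 0 = uu * uu' := by
  simp [siteMoment, blochMoment, bloch, Fin.sum_univ_four]

lemma siteMoment_one (uu ux xx yy uu' ux' xx' yy' : ℝ) :
    siteMoment (blochMoment 1 uu ux xx yy) (blochMoment 0 uu' ux' xx' yy') 1 1 3 3 = yy * xx' := by
  simp [siteMoment, blochMoment, bloch, Fin.sum_univ_four]

lemma siteMoment_two (uu ux xx yy uu' ux' xx' yy' : ℝ) :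
    siteMoment (blochMoment 1 uu ux xx yy) (blochMoment 0 uu' ux' xx' yy') 2 2 3 3 = uu * yy' := by
  simp [siteMoment, blochMoment, bloch, Fin.sum_univ_four]

lemma siteMoment_three (uu ux xx yy uu' ux' xx' yy' : ℝ) :
    siteMoment (blochMoment 1 uu ux xx yy) (blochMoment 0 uu' ux' xx' yy') 3 3 3 3 = xx * xx' := by
  simp [siteMoment, blochMoment, bloch, Fin.sum_univ_four]

end Site

section Layers
variable {N : ℕ}

lemma flips_rev (p : Fin 4) : flips p.rev ↔ flips p := by
  fin_cases p <;> decide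

lemma flips_czLabel (p : QubitPair N) (R : Fin N → Fin 4) (n : Fin N) :
    flips (czLabel p R n) ↔ flips (R n) := by
  unfold czLabel
  split_ifs
  · exact flips_rev _
  · rfl

lemma Compatible.flips_iff {p p' : Fin 4} (h : Compatible p p') : flips p ↔ flips p' := by
  rcases h with rfl | h
  · rfl
  · simp [h.1, h.2]

lemma Compatible.eq_of_flips {p p' : Fin 4} (h : Compatible p p') (hp : flips p) : p = p' :=
  h.resolve_right fun h' => h'.1 hp

lemma compatible_of_czLabel (p : QubitPair N) {R R' : Fin N → Fin 4}
    (h : ∀ n, Compatible (czLabel p R n) (czLabel p R' n)) : ∀ n, Compatible (R n) (R' n) := by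
  have hf : ∀ n, flips (R n) ↔ flips (R' n) := fun n => by
    rw [← flips_czLabel p R, ← flips_czLabel p R', (h n).flips_iff]
  intro n
  by_cases hn : flips (R n)
  · left
    have := (h n).eq_of_flips ((flips_czLabel p R n).2 hn)
    simp only [czLabel, hf] at this
    split_ifs at this
    · exact Fin.rev_injective this
    · exact this
  · exact Or.inr ⟨hn, fun h' => hn ((hf n).2 h')⟩

lemma czSign_eq (p : QubitPair N) {R R' : Fin N → Fin 4} (h : ∀ n, Compatible (R n) (R' n)) :
    czSign p R = czSign p R' := by
  have : (flips (R p.1.1) ∧ flips (R p.1.2) ∧ R p.1.1 ≠ R p.1.2) ↔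
      (flips (R' p.1.1) ∧ flips (R' p.1.2) ∧ R' p.1.1 ≠ R' p.1.2) := by
    constructor
    · rintro ⟨h1, h2, h3⟩
      rw [← (h _).eq_of_flips h1, ← (h _).eq_of_flips h2]
      exact ⟨h1, h2, h3⟩
    · rintro ⟨h1, h2, h3⟩
      rw [(h _).eq_of_flips ((h _).flips_iff.2 h1), (h _).eq_of_flips ((h _).flips_iff.2 h2)]
      exact ⟨h1, h2, h3⟩
  simp only [czSign, this]

lemma compatible_of_layerLabel (E : List (QubitPair N)) {R R' : Fin N → Fin 4}
    (h : ∀ n, Compatible (layerLabel E R n) (layerLabel E R' n)) :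
    (∀ n, Compatible (R n) (R' n)) ∧ layerSign E R = layerSign E R' := by
  induction E generalizing R R' with
  | nil => exact ⟨h, rfl⟩
  | cons p E ih =>
    obtain ⟨h1, h2⟩ := ih h
    have h3 := compatible_of_czLabel p h1
    exact ⟨h3, by rw [layerSign, layerSign, czSign_eq p h3, h2]⟩

lemma layerLabel_of_not_flips (E : List (QubitPair N)) {R : Fin N → Fin 4} (h : ∀ n, ¬flips (R n)) :
    layerLabel E R = R := by
  induction E with
  | nil => rfl
  | cons p E ih =>
    have : czLabel p R = R := by ext n; simp [czLabel, h]
    rw [layerLabel, this, ih]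

lemma czSign_mul_self (p : QubitPair N) (R : Fin N → Fin 4) : czSign p R * czSign p R = 1 := by
  unfold czSign; split_ifs <;> norm_num

lemma layerSign_mul_self (E : List (QubitPair N)) (R : Fin N → Fin 4) :
    layerSign E R * layerSign E R = 1 := by
  induction E generalizing R with
  | nil => simp [layerSign]
  | cons p E ih => rw [layerSign, mul_mul_mul_comm, czSign_mul_self, ih, one_mul]

end Layers

section Positivity
variable {N : ℕ} (E : ℕ → List (QubitPair N))
  (m : ℕ → Fin 2 → Fin N → Fin 4 → Fin 4 → Fin 4 → Fin 4 → ℝ)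

lemma twoCopy_succ (k : ℕ) (P P' : Fin N → Fin 4) :
    twoCopy E m (k + 1) P P' = ∑ R : Fin N → Fin 4, ∑ R' : Fin N → Fin 4,
      (∏ n, siteMoment (m k 1 n) (m k 0 n) (P n) (P' n) (R n) (R' n)) *
        ((layerSign (E k) R * layerSign (E k) R') *
          twoCopy E m k (layerLabel (E k) R) (layerLabel (E k) R')) := by
  have key : ∀ R R' : Fin N → Fin 4,
      ∏ n, siteMoment (m k 1 n) (m k 0 n) (P n) (P' n) (R n) (R' n)
      = ∑ Q : Fin N → Fin 4, ∑ Q' : Fin N → Fin 4,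
        (∏ n, m k 1 n (P n) (P' n) (Q n) (Q' n)) * ∏ n, m k 0 n (Q n) (Q' n) (R n) (R' n) := by
    intro R R'
    simp only [siteMoment]
    rw [Finset.prod_univ_sum, Fintype.piFinset_univ]
    refine Finset.sum_congr rfl fun Q _ => ?_
    rw [Finset.prod_univ_sum, Fintype.piFinset_univ]
    simp only [Finset.prod_mul_distrib]
  simp only [twoCopy, key, Fintype.sum_prod_type, Finset.sum_mul]
  rw [Finset.sum_comm]
  refine Finset.sum_congr rfl fun R _ => ?_
  exact (Finset.sum_congr rfl fun Q _ => Finset.sum_comm).trans Finset.sum_comm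

variable {m}

/-- The one-qubit second moments of each block are nonnegative on compatible pairs, and vanish when
they lead from an incompatible pair to a compatible one. -/
def PreservesCompatible (m : ℕ → Fin 2 → Fin N → Fin 4 → Fin 4 → Fin 4 → Fin 4 → ℝ) : Prop :=
  ∀ k n p p' r r', Compatible r r' →
    0 ≤ siteMoment (m k 1 n) (m k 0 n) p p' r r' ∧
      (siteMoment (m k 1 n) (m k 0 n) p p' r r' ≠ 0 → Compatible p p')

lemma twoCopy_summand (hm : PreservesCompatible m) (k : ℕ)
    (ih : ∀ P P', 0 ≤ twoCopy E m k P P' ∧ (twoCopy E m k P P' ≠ 0 → ∀ n, Compatible (P n) (P' n)))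
    (P P' R R' : Fin N → Fin 4) :
    0 ≤ (∏ n, siteMoment (m k 1 n) (m k 0 n) (P n) (P' n) (R n) (R' n)) *
        ((layerSign (E k) R * layerSign (E k) R') *
          twoCopy E m k (layerLabel (E k) R) (layerLabel (E k) R')) ∧
    ((∏ n, siteMoment (m k 1 n) (m k 0 n) (P n) (P' n) (R n) (R' n)) *
        ((layerSign (E k) R * layerSign (E k) R') *
          twoCopy E m k (layerLabel (E k) R) (layerLabel (E k) R')) ≠ 0 →
      ∀ n, Compatible (P n) (P' n)) := by
  obtain ⟨h1, h2⟩ := ih (layerLabel (E k) R) (layerLabel (E k) R')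
  by_cases h : twoCopy E m k (layerLabel (E k) R) (layerLabel (E k) R') = 0
  · simp [h]
  · obtain ⟨h3, h4⟩ := compatible_of_layerLabel (E k) (h2 h)
    rw [h4, layerSign_mul_self, one_mul]
    refine ⟨mul_nonneg (Finset.prod_nonneg fun n _ => (hm k n _ _ _ _ (h3 n)).1) h1,
      fun h0 n => (hm k n _ _ _ _ (h3 n)).2 ?_⟩
    exact Finset.prod_ne_zero_iff.1 (left_ne_zero_of_mul h0) n (Finset.mem_univ n)

lemma twoCopy_nonneg_and (hm : PreservesCompatible m) (k : ℕ) (P P' : Fin N → Fin 4) :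
    0 ≤ twoCopy E m k P P' ∧ (twoCopy E m k P P' ≠ 0 → ∀ n, Compatible (P n) (P' n)) := by
  induction k generalizing P P' with
  | zero =>
    simp only [twoCopy]
    refine ⟨by positivity, fun h n => Or.inr ?_⟩
    have h1 := left_ne_zero_of_mul h
    have h2 := right_ne_zero_of_mul h
    simp only [ne_eq, ite_eq_left_iff, one_ne_zero, imp_false, not_not, not_exists] at h1 h2
    exact ⟨h1 n, h2 n⟩
  | succ k ih =>
    rw [twoCopy_succ]
    refine ⟨Finset.sum_nonneg fun R _ => Finset.sum_nonneg fun R' _ =>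
      (twoCopy_summand E hm k ih P P' R R').1, fun h => ?_⟩
    obtain ⟨R, _, h⟩ := Finset.exists_ne_zero_of_sum_ne_zero h
    obtain ⟨R', _, h⟩ := Finset.exists_ne_zero_of_sum_ne_zero h
    exact (twoCopy_summand E hm k ih P P' R R').2 h

lemma twoCopy_nonneg (hm : PreservesCompatible m) (k : ℕ) (P P' : Fin N → Fin 4) : 0 ≤ twoCopy E m k P P' :=
  (twoCopy_nonneg_and E hm k P P').1

lemma le_twoCopy_succ (hm : PreservesCompatible m) (k : ℕ) (P : Fin N → Fin 4)
    {R : Fin N → Fin 4} (hR : ∀ n, ¬flips (R n)) :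
    (∏ n, siteMoment (m k 1 n) (m k 0 n) (P n) (P n) (R n) (R n)) * twoCopy E m k R R
      ≤ twoCopy E m (k + 1) P P := by
  have h := fun R R' => (twoCopy_summand E hm k (twoCopy_nonneg_and E hm k) P P R R').1
  rw [twoCopy_succ]
  refine le_trans ?_ (Finset.single_le_sum (fun R _ => Finset.sum_nonneg fun R' _ => h R R')
    (Finset.mem_univ R))
  refine le_trans ?_ (Finset.single_le_sum (fun R' _ => h R R') (Finset.mem_univ R))
  rw [layerSign_mul_self, one_mul, layerLabel_of_not_flips _ hR]

end Positivity

section LowerBound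
variable {L N : ℕ} {a : ℝ}

lemma moments_diffRot (ha : 0 < a) (q : ParamIndex L N) (l : ℕ) (b : Fin 2) (n : Fin N) :
    moments a (diffRot q) l b n = if l = q.1 ∧ b = q.2.1 ∧ n = q.2.2
      then blochMoment b 0 0 (beta a) (alpha a)
      else blochMoment b 1 (∫ t, Real.cos t ∂(angleLaw a)) (alpha a) (beta a) := by
  ext p p' r r'
  simp only [moments, diffRot]
  split_ifs
  · exact integral_blochDeriv_mul ha b p p' r r'
  · exact integral_blochRot_mul ha b p p' r r'

/-- The second moments of the action of one qubit's rotations in one block. -/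
def site (a : ℝ) (q : ParamIndex L N) (l : ℕ) (n : Fin N) : Fin 4 → Fin 4 → Fin 4 → Fin 4 → ℝ :=
  siteMoment (moments a (diffRot q) l 1 n) (moments a (diffRot q) l 0 n)

lemma site_nonneg (ha : 0 < a) (q : ParamIndex L N) (l : ℕ) (n : Fin N) {p p' r r' : Fin 4}
    (hr : Compatible r r') :
    0 ≤ site a q l n p p' r r' ∧ (site a q l n p p' r r' ≠ 0 → Compatible p p') := by
  have hα := alpha_nonneg ha
  have hβ := beta_nonneg ha
  rw [site, moments_diffRot ha, moments_diffRot ha]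
  split_ifs <;> apply siteMoment_nonneg <;>
    first | assumption | positivity | simp [mul_self_nonneg]

lemma preservesCompatible_moments (ha : 0 < a) (q : ParamIndex L N) :
    PreservesCompatible (moments a (diffRot q)) :=
  fun k n _ _ _ _ h => site_nonneg ha q k n h

lemma site_zero (ha : 0 < a) {q : ParamIndex L N} {l : ℕ} {n : Fin N}
    (h : ¬(l = q.1 ∧ n = q.2.2)) : site a q l n 0 0 0 0 = 1 := by
  rw [site, moments_diffRot ha, moments_diffRot ha, if_neg (by tauto), if_neg (by tauto),
    siteMoment_zero, one_mul]

lemma site_three (ha : 0 < a) {q : ParamIndex L N} {l : ℕ} {n : Fin N}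
    (h : ¬(l = q.1 ∧ n = q.2.2)) : site a q l n 3 3 3 3 = alpha a ^ 2 := by
  rw [site, moments_diffRot ha, moments_diffRot ha, if_neg (by tauto), if_neg (by tauto),
    siteMoment_three, sq]

lemma site_three_diff (ha : 0 < a) (q : ParamIndex L N) :
    site a q q.1 q.2.2 3 3 3 3 = alpha a * beta a := by
  rw [site, moments_diffRot ha, moments_diffRot ha]
  have hb : q.2.1 = 0 ∨ q.2.1 = 1 := by generalize q.2.1 = b; fin_cases b <;> simp
  rcases hb with hb | hb <;> simp [hb, siteMoment_three, mul_comm]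

lemma le_site_three (ha : 0 < a) {q : ParamIndex L N} {l : ℕ} {n : Fin N}
    (h : ¬(l = q.1 ∧ n = q.2.2)) {p : Fin 4} (hp : p ≠ 0) :
    alpha a ^ 2 * beta a ≤ site a q l n p p 3 3 := by
  have hα := alpha_nonneg ha
  have hβ := beta_nonneg ha
  have hs := alpha_add_beta a
  have hα1 : alpha a ≤ 1 := by linarith
  have hβ1 : beta a ≤ 1 := by linarith
  have hα2 : alpha a ^ 2 ≤ alpha a := by nlinarith
  rw [site, moments_diffRot ha, moments_diffRot ha, if_neg (by tauto), if_neg (by tauto)]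
  fin_cases p
  · exact absurd rfl hp
  · refine le_trans ?_ (siteMoment_one ..).ge
    nlinarith
  · refine le_trans ?_ (siteMoment_two ..).ge
    nlinarith
  · refine le_trans ?_ (siteMoment_three ..).ge
    nlinarith [sq_nonneg (alpha a)]

lemma prod_support (P : Fin N → Fin 4) (c : ℝ) :
    ∏ n, (if P n = 0 then 1 else c) = c ^ locality P := by
  rw [Finset.prod_ite, Finset.prod_const_one, one_mul, Finset.prod_const, locality]

lemma prod_support_of_mem (P : Fin N → Fin 4) {n₀ : Fin N} (hn : P n₀ ≠ 0) (c d : ℝ) :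
    ∏ n, (if n = n₀ then d else if P n = 0 then 1 else c) = d * c ^ (locality P - 1) := by
  rw [← Finset.mul_prod_erase _ _ (Finset.mem_univ n₀), if_pos rfl]
  congr 1
  have : ∏ n ∈ Finset.univ.erase n₀, (if n = n₀ then d else if P n = 0 then 1 else c)
      = ∏ n ∈ Finset.univ.erase n₀, (if P n = 0 then 1 else c) :=
    Finset.prod_congr rfl fun n hn => if_neg (Finset.ne_of_mem_erase hn)
  rw [this, Finset.prod_ite, Finset.prod_const_one, one_mul, Finset.prod_const, locality,
    Finset.filter_erase, Finset.card_erase_of_mem (by simp [hn])]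

lemma le_twoCopy_of_not_flips (ha : 0 < a) (E : ℕ → List (QubitPair N)) (q : ParamIndex L N)
    {Z : Fin N → Fin 4} (hZ : ∀ n, Z n = 0 ∨ Z n = 3) (hq : Z q.2.2 ≠ 0) (k : ℕ) :
    (if k ≤ q.1 then (alpha a ^ 2) ^ (locality Z * k)
      else alpha a * beta a * (alpha a ^ 2) ^ (locality Z * k - 1))
      ≤ twoCopy E (moments a (diffRot q)) k Z Z := by
  have hα := alpha_nonneg ha
  have hβ := beta_nonneg ha
  have hf : ∀ n, ¬flips (Z n) := fun n => by rcases hZ n with h | h <;> rw [h] <;> decide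
  have hs : 1 ≤ locality Z := Finset.card_pos.2 ⟨q.2.2, by simp [hq]⟩
  have hm := preservesCompatible_moments ha q
  induction k with
  | zero => simp [twoCopy, hf]
  | succ k ih =>
    refine le_trans ?_ (le_twoCopy_succ E hm k Z hf)
    change _ ≤ (∏ n, site a q k n (Z n) (Z n) (Z n) (Z n)) * _
    by_cases hk : k = q.1
    · have : ∏ n, site a q k n (Z n) (Z n) (Z n) (Z n)
          = alpha a * beta a * (alpha a ^ 2) ^ (locality Z - 1) := by
        rw [← prod_support_of_mem Z hq]
        refine Finset.prod_congr rfl fun n _ => ?_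
        split_ifs with h1 h2
        · rw [h1, (hZ _).resolve_left hq, hk, site_three_diff ha]
        · rw [h2, site_zero ha (by tauto)]
        · rw [(hZ n).resolve_left h2, site_three ha (by tauto)]
      rw [this, if_neg (by omega)]
      rw [if_pos hk.le] at ih
      refine le_trans (le_of_eq ?_) (mul_le_mul_of_nonneg_left ih (by positivity))
      rw [mul_assoc _ (_ ^ _), ← pow_add]
      congr 2
      rw [mul_add, mul_one]; omega
    · have : ∏ n, site a q k n (Z n) (Z n) (Z n) (Z n) = (alpha a ^ 2) ^ locality Z := by
        rw [← prod_support Z]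
        refine Finset.prod_congr rfl fun n _ => ?_
        split_ifs with h2
        · rw [h2, site_zero ha (by tauto)]
        · rw [(hZ n).resolve_left h2, site_three ha (by tauto)]
      rw [this]
      refine le_trans (le_of_eq ?_) (mul_le_mul_of_nonneg_left ih (by positivity))
      by_cases hl : k + 1 ≤ q.1
      · rw [if_pos hl, if_pos (by omega), ← pow_add]
        congr 1; ring
      · have hk1 : 1 ≤ k := by omega
        have : 1 ≤ locality Z * k := Nat.mul_pos hs hk1
        rw [if_neg hl, if_neg (by omega), mul_left_comm, ← pow_add]
        congr 2
        rw [mul_add, mul_one]; omega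

lemma le_twoCopy (ha : 0 < a) (E : ℕ → List (QubitPair N)) (q : ParamIndex (L + 1) N)
    (hl : (q.1 : ℕ) < L) {S : ℕ} {P : Fin N → Fin 4} (hP : locality P ≤ S) (hq : P q.2.2 ≠ 0) :
    alpha a ^ (2 * S * (L + 1) - 1) * beta a ^ (S + 1)
      ≤ twoCopy E (moments a (diffRot q)) (L + 1) P P := by
  have hα := alpha_nonneg ha
  have hβ := beta_nonneg ha
  have hsum := alpha_add_beta a
  set Z : Fin N → Fin 4 := fun n => if P n = 0 then 0 else 3 with hZ
  have hZ' : ∀ n, Z n = 0 ∨ Z n = 3 := fun n => by simp only [hZ]; split_ifs <;> simp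
  have hf : ∀ n, ¬flips (Z n) := fun n => by rcases hZ' n with h | h <;> rw [h] <;> decide
  have hloc : locality Z = locality P := by
    unfold locality
    congr 1; ext n
    by_cases h : P n = 0 <;> simp [hZ, h]
  have hs : 1 ≤ locality P := Finset.card_pos.2 ⟨q.2.2, by simp [hq]⟩
  have hm := preservesCompatible_moments ha q
  refine le_trans ?_ (le_twoCopy_succ E hm L P hf)
  have h1 := le_twoCopy_of_not_flips ha E q hZ' (by simp [hZ, hq]) L
  rw [if_neg (by omega), hloc] at h1
  have h2 : (alpha a ^ 2 * beta a) ^ locality P ≤ ∏ n, site a q L n (P n) (P n) (Z n) (Z n) := by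
    rw [← prod_support P]
    refine Finset.prod_le_prod (fun n _ => by split_ifs <;> positivity) fun n _ => ?_
    split_ifs with h
    · simp only [hZ, h, if_true]
      rw [site_zero ha (by omega)]
    · simp only [hZ, h, if_false]
      exact le_site_three ha (by omega) h
  refine le_trans ?_ (mul_le_mul h2 h1 (by positivity) (le_trans (by positivity) h2))
  have e : (alpha a ^ 2 * beta a) ^ locality P *
      (alpha a * beta a * (alpha a ^ 2) ^ (locality P * L - 1))
      = alpha a ^ (2 * locality P * (L + 1) - 1) * beta a ^ (locality P + 1) := by
    have : 1 ≤ locality P * L := Nat.mul_pos hs (by omega)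
    have e2 : 2 * locality P * (L + 1) - 1
        = 2 * locality P + (1 + 2 * (locality P * L - 1)) := by
      rw [mul_add, mul_one, mul_assoc]; omega
    rw [e2, mul_pow, ← pow_mul, ← pow_mul, pow_add, pow_add, pow_succ (beta a)]
    ring
  rw [e]
  refine mul_le_mul (pow_le_pow_of_le_one hα (by linarith) ?_)
    (pow_le_pow_of_le_one hβ (by linarith) (by omega)) (by positivity) (by positivity)
  gcongr

lemma le_integral_gradSq (ha : 0 < a) (hL : 1 ≤ L) {S : ℕ} (𝒩 : Finset (Fin N → Fin 4))
    (h𝒩 : ∀ i ∈ 𝒩, 1 ≤ locality i ∧ locality i ≤ S) (E : Fin L → List (QubitPair N)) :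
    2 * (𝒩.card : ℝ) * ((L : ℝ) - 1) * alpha a ^ (2 * S * L - 1) * beta a ^ (S + 1)
      ≤ ∫ θ, gradSq 𝒩 E θ ∂(paramLaw L N a) := by
  obtain ⟨L, rfl⟩ : ∃ M, L = M + 1 := ⟨L - 1, by omega⟩
  have hα := alpha_nonneg ha
  have hβ := beta_nonneg ha
  rw [integral_gradSq ha]
  have hnn : ∀ (q : ParamIndex (L + 1) N) P P',
      0 ≤ twoCopy (layers E) (moments a (diffRot q)) (L + 1) P P' := fun q P P' =>
    twoCopy_nonneg _ (preservesCompatible_moments ha q) _ _ _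
  set B := alpha a ^ (2 * S * (L + 1) - 1) * beta a ^ (S + 1) with hB
  have h1 : ∀ P ∈ 𝒩, 2 * (L : ℝ) * B
      ≤ ∑ q : ParamIndex (L + 1) N, twoCopy (layers E) (moments a (diffRot q)) (L + 1) P P := by
    intro P hP
    obtain ⟨n, hn⟩ := Finset.card_pos.1 (h𝒩 P hP).1
    simp only [Finset.mem_filter, Finset.mem_univ, true_and] at hn
    have h2 : ∑ x : Fin L × Fin 2, B ≤ ∑ x : Fin L × Fin 2,
        twoCopy (layers E) (moments a (diffRot (x.1.castSucc, x.2, n))) (L + 1) P P :=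
      Finset.sum_le_sum fun x _ => le_twoCopy ha _ (x.1.castSucc, x.2, n) x.1.2 (h𝒩 P hP).2 hn
    have h3 : ∑ x : Fin L × Fin 2, B = 2 * (L : ℝ) * B := by
      simp [mul_comm (L : ℝ)]
    rw [← h3]
    refine h2.trans ?_
    let f : Fin L × Fin 2 ↪ ParamIndex (L + 1) N := ⟨fun x => (x.1.castSucc, x.2, n), by
      rintro ⟨l, b⟩ ⟨l', b'⟩ h
      simp only [Prod.mk.injEq, Fin.castSucc_inj, and_true] at h
      rw [h.1, h.2]⟩
    refine (Finset.sum_map Finset.univ f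
      fun q => twoCopy (layers E) (moments a (diffRot q)) (L + 1) P P).ge.trans ?_
    exact Finset.sum_le_sum_of_subset_of_nonneg (Finset.subset_univ _) fun q _ _ => hnn q P P
  calc _ = ∑ P ∈ 𝒩, 2 * (L : ℝ) * B := by
        rw [Finset.sum_const, nsmul_eq_mul, hB]; push_cast; ring
    _ ≤ ∑ P ∈ 𝒩, ∑ q : ParamIndex (L + 1) N, twoCopy (layers E) (moments a (diffRot q)) (L + 1) P P :=
        Finset.sum_le_sum h1
    _ = ∑ q : ParamIndex (L + 1) N, ∑ P ∈ 𝒩, twoCopy (layers E) (moments a (diffRot q)) (L + 1) P P := Finset.sum_comm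
    _ ≤ _ := Finset.sum_le_sum fun q _ => Finset.sum_le_sum fun P hP =>
        Finset.single_le_sum (fun P' _ => hnn q P P') hP

end LowerBound

section Tuned
variable {S L : ℕ} {a : ℝ}

lemma IsTuned.sin_div (h : IsTuned S L a) (hS : 1 ≤ S) :
    1 - Real.sin (2 * a * Real.pi) / (2 * a * Real.pi)
      = 2 * ((S : ℝ) + 1) / ((S : ℝ) * (2 * L + 1)) := by
  have hS' : (0 : ℝ) < S := by exact_mod_cast hS
  have hL' : (0 : ℝ) < 2 * L + 1 := by positivity
  rw [h]
  field_simp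
  ring

lemma IsTuned.beta_eq (h : IsTuned S L a) (hS : 1 ≤ S) :
    beta a = ((S : ℝ) + 1) / ((S : ℝ) * (2 * L + 1)) := by
  have e : Real.sin (2 * a * Real.pi) / (a * Real.pi)
      = 2 * (Real.sin (2 * a * Real.pi) / (2 * a * Real.pi)) := by
    rw [mul_assoc 2 a, mul_div_assoc', mul_div_mul_left _ _ two_ne_zero]
  have := h.sin_div hS
  rw [mul_div_assoc] at this
  rw [beta, e]
  linarith

lemma IsTuned.exp_neg_le (h : IsTuned S L a) (hS : 1 ≤ S) (hL : 1 ≤ L) :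
    Real.exp (-((S : ℝ) + 1)) ≤ alpha a ^ (2 * S * L - 1) := by
  have hS' : (1 : ℝ) ≤ S := by exact_mod_cast hS
  have hL' : (1 : ℝ) ≤ L := by exact_mod_cast hL
  have hSL : 1 ≤ S * L := Nat.mul_pos hS hL
  set M := 2 * S * L - 1 with hM
  have hMr : (M : ℝ) = 2 * S * L - 1 := by
    rw [hM, Nat.cast_sub (by rw [mul_assoc]; omega)]; push_cast; ring
  have hMpos : (0 : ℝ) < M := by rw [hMr]; nlinarith
  have hα : alpha a = (1 + ((S : ℝ) + 1) / M)⁻¹ := by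
    have h1 := alpha_add_beta a
    rw [h.beta_eq hS] at h1
    have h2 : alpha a = 1 - ((S : ℝ) + 1) / ((S : ℝ) * (2 * L + 1)) := by linarith
    have h3 : 1 + ((S : ℝ) + 1) / M = (S : ℝ) * (2 * L + 1) / M := by
      field_simp; rw [hMr]; ring
    rw [h2, h3, inv_div, hMr]
    field_simp
    ring
  have h4 : Real.exp (-(((S : ℝ) + 1) / M)) ≤ alpha a := by
    rw [hα, Real.exp_neg]
    refine inv_anti₀ (by positivity) ?_
    rw [add_comm]
    exact Real.add_one_le_exp _
  calc Real.exp (-((S : ℝ) + 1)) = Real.exp (-(((S : ℝ) + 1) / M)) ^ M := by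
        rw [← Real.exp_nat_mul]
        congr 1
        field_simp
    _ ≤ _ := pow_le_pow_left₀ (Real.exp_pos _).le h4 _

lemma IsTuned.bound_le (h : IsTuned S L a) (hS : 1 ≤ S) (hL : 1 ≤ L) (c : ℕ) :
    2 * (c : ℝ) * (((S : ℝ) + 1) / (Real.exp 1 * S)) ^ (S + 1)
        * (((L : ℝ) - 1) / (2 * (L : ℝ) + 1) ^ (S + 1))
      ≤ 2 * (c : ℝ) * ((L : ℝ) - 1) * alpha a ^ (2 * S * L - 1) * beta a ^ (S + 1) := by
  have hS' : (1 : ℝ) ≤ S := by exact_mod_cast hS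
  have hL' : (0 : ℝ) ≤ (L : ℝ) - 1 := by
    rw [sub_nonneg]; exact_mod_cast hL
  rw [h.beta_eq hS]
  have h1 := h.exp_neg_le hS hL
  have e : 2 * (c : ℝ) * (((S : ℝ) + 1) / (Real.exp 1 * S)) ^ (S + 1)
        * (((L : ℝ) - 1) / (2 * (L : ℝ) + 1) ^ (S + 1))
      = 2 * (c : ℝ) * ((L : ℝ) - 1) * Real.exp (-((S : ℝ) + 1))
        * (((S : ℝ) + 1) / ((S : ℝ) * (2 * L + 1))) ^ (S + 1) := by
    have : Real.exp (-((S : ℝ) + 1)) = (Real.exp 1 ^ (S + 1))⁻¹ := by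
      rw [Real.exp_neg, ← Real.exp_nat_mul]; push_cast; rw [mul_one]
    rw [this, div_pow, div_pow, mul_pow, mul_pow]
    field_simp
  rw [e]
  gcongr

end Tuned

section Sinc

lemma sin_div_strictAntiOn : StrictAntiOn (fun x : ℝ => Real.sin x / x) (Set.Ioc 0 Real.pi) := by
  intro x hx y hy hxy
  have h := strictConcaveOn_sin_Icc.2 ⟨le_rfl, Real.pi_pos.le⟩ ⟨hy.1.le, hy.2⟩ hy.1.ne
    (sub_pos.2 ((div_lt_one hy.1).2 hxy)) (div_pos hx.1 hy.1) (sub_add_cancel 1 (x / y))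
  simp only [smul_eq_mul, mul_zero, zero_add, Real.sin_zero, div_mul_cancel₀ x hy.1.ne'] at h
  change Real.sin y / y < Real.sin x / x
  rw [lt_div_iff₀ hx.1]
  calc _ = x / y * Real.sin y := by ring
    _ < _ := h

lemma le_pi_of_sin_div_nonneg {x : ℝ} (hx : 0 < x) (hx2 : x < 2 * Real.pi)
    (h : 0 ≤ Real.sin x / x) : x ≤ Real.pi := by
  by_contra! hlt
  have : Real.sin (x - 2 * Real.pi) < 0 := Real.sin_neg_of_neg_of_neg_pi_lt (by linarith) (by linarith)
  rw [Real.sin_sub_two_pi] at this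
  exact absurd h (not_le.2 (div_neg_of_neg_of_pos this hx))

lemma exists_sin_div_eq {s : ℝ} (h0 : 0 ≤ s) (h1 : s < 1) :
    ∃ x ∈ Set.Ioc 0 Real.pi, Real.sin x / x = s := by
  have := intermediate_value_Icc' Real.pi_pos.le Real.continuous_sinc.continuousOn
  have hs : s ∈ Set.Icc (Real.sinc Real.pi) (Real.sinc 0) := by
    rw [Real.sinc_zero, Real.sinc_of_ne_zero Real.pi_ne_zero, Real.sin_pi, zero_div]
    exact ⟨h0, h1.le⟩
  obtain ⟨x, hx, rfl⟩ := this hs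
  have hx0 : x ≠ 0 := by
    rintro rfl
    simp at h1
  exact ⟨x, ⟨lt_of_le_of_ne hx.1 hx0.symm, hx.2⟩, (Real.sinc_of_ne_zero hx0).symm⟩

lemma one_sub_sin_div_lt {x : ℝ} (hx : 0 < x) : 1 - Real.sin x / x < x ^ 2 / 6 := by
  have h := Real.sin_gt_sub_cube hx
  have : 1 - x ^ 2 / 6 < Real.sin x / x := by
    rw [lt_div_iff₀ hx]; linarith
  linarith

lemma le_one_sub_sin_div {x : ℝ} (hx : 0 < x) (hx' : x ≤ Real.pi) :
    x ^ 2 / (2 * Real.pi ^ 2) ≤ 1 - Real.sin x / x := by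
  have hpi := Real.pi_pos
  have h1 : Real.cos (x / 2) ≤ 1 - 2 / Real.pi ^ 2 * (x / 2) ^ 2 :=
    Real.cos_le_one_sub_mul_cos_sq (by rw [abs_of_pos (by linarith)]; linarith)
  have h2 : 0 ≤ Real.cos (x / 2) := Real.cos_nonneg_of_mem_Icc ⟨by linarith, by linarith⟩
  have h3 : Real.sin (x / 2) ≤ x / 2 := Real.sin_le (by linarith)
  have h4 : Real.sin x = 2 * Real.sin (x / 2) * Real.cos (x / 2) := by
    rw [← Real.sin_two_mul]; ring_nf
  have h5 : Real.sin x / x ≤ Real.cos (x / 2) := by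
    rw [div_le_iff₀ hx, h4]; nlinarith
  have h6 : 2 / Real.pi ^ 2 * (x / 2) ^ 2 = x ^ 2 / (2 * Real.pi ^ 2) := by
    field_simp
  linarith

variable {S L : ℕ} {a : ℝ}

lemma tuned_value_nonneg (hS : 1 ≤ S) (hL : 1 ≤ L) (h : ¬(S = 1 ∧ L = 1)) :
    0 ≤ ((S : ℝ) * (2 * L - 1) - 2) / ((S : ℝ) * (2 * L + 1)) := by
  have hS' : (1 : ℝ) ≤ S := by exact_mod_cast hS
  have hL' : (1 : ℝ) ≤ L := by exact_mod_cast hL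
  refine div_nonneg ?_ (by positivity)
  rcases Nat.lt_or_ge 1 S with h2 | h2
  · have : (2 : ℝ) ≤ S := by exact_mod_cast h2
    nlinarith
  · have : (2 : ℝ) ≤ L := by
      have : 2 ≤ L := by omega
      exact_mod_cast this
    nlinarith

lemma tuned_value_lt_one (hS : 1 ≤ S) :
    ((S : ℝ) * (2 * L - 1) - 2) / ((S : ℝ) * (2 * L + 1)) < 1 := by
  have hS' : (1 : ℝ) ≤ S := by exact_mod_cast hS
  rw [div_lt_one (by positivity)]
  nlinarith

lemma IsTuned.le_pi (h : IsTuned S L a) (ha : a ∈ Set.Ioo (0 : ℝ) 1) (hS : 1 ≤ S) (hL : 1 ≤ L)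
    (hSL : ¬(S = 1 ∧ L = 1)) : 2 * a * Real.pi ≤ Real.pi := by
  have hpi := Real.pi_pos
  refine le_pi_of_sin_div_nonneg (mul_pos (mul_pos two_pos ha.1) hpi) ?_ ?_
  · have := ha.2; nlinarith
  · rw [h]; exact tuned_value_nonneg hS hL hSL

lemma existsUnique_isTuned (hS : 1 ≤ S) (hL : 1 ≤ L) (hSL : ¬(S = 1 ∧ L = 1)) :
    ∃! a : ℝ, a ∈ Set.Ioo (0 : ℝ) 1 ∧ IsTuned S L a := by
  have hpi := Real.pi_pos
  obtain ⟨x, hx, hxs⟩ := exists_sin_div_eq (tuned_value_nonneg hS hL hSL) (tuned_value_lt_one hS)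
  have e : 2 * (x / (2 * Real.pi)) * Real.pi = x := by field_simp
  refine ⟨x / (2 * Real.pi), ⟨⟨div_pos hx.1 (by positivity), ?_⟩, ?_⟩, ?_⟩
  · rw [div_lt_one (by positivity)]; linarith [hx.2]
  · rw [IsTuned, e, hxs]
  · rintro b ⟨hb, hbt⟩
    have hbx : 2 * b * Real.pi = x :=
      sin_div_strictAntiOn.injOn ⟨mul_pos (mul_pos two_pos hb.1) hpi, hbt.le_pi hb hS hL hSL⟩ hx
        (hbt.trans hxs.symm)
    rw [← hbx]; field_simp

lemma IsTuned.div_sqrt_le (h : IsTuned S L a) (ha : a ∈ Set.Ioo (0 : ℝ) 1) (hS : 1 ≤ S)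
    (hL : 1 ≤ L) : 1 / Real.pi / Real.sqrt L ≤ a := by
  have hpi := Real.pi_pos
  have hS' : (1 : ℝ) ≤ S := by exact_mod_cast hS
  have hL' : (1 : ℝ) ≤ L := by exact_mod_cast hL
  have hsq : 0 < Real.sqrt L := Real.sqrt_pos.2 (by linarith)
  have h1 := one_sub_sin_div_lt (mul_pos (mul_pos two_pos ha.1) hpi)
  rw [h.sin_div hS] at h1
  have h2 : 2 / (3 * (L : ℝ)) ≤ 2 * ((S : ℝ) + 1) / ((S : ℝ) * (2 * L + 1)) := by
    rw [div_le_div_iff₀ (by positivity) (by positivity)]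
    nlinarith
  have h3 : 1 / (L : ℝ) ≤ (a * Real.pi) ^ 2 := by
    have : 2 / (3 * (L : ℝ)) = 2 / 3 * (1 / L) := by field_simp
    nlinarith
  rw [div_div, div_le_iff₀ (by positivity)]
  rw [div_le_iff₀ (by linarith)] at h3
  have h4 : 1 ≤ (a * Real.pi * Real.sqrt L) ^ 2 := by
    rw [mul_pow, Real.sq_sqrt (by linarith)]; exact h3
  have := (one_le_sq_iff₀ (by have := ha.1; positivity)).1 h4
  linarith

lemma IsTuned.le_div_sqrt (h : IsTuned S L a) (ha : a ∈ Set.Ioo (0 : ℝ) 1) (hS : 1 ≤ S)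
    (hL : 1 ≤ L) : a ≤ 1 / Real.sqrt L := by
  have hpi := Real.pi_pos
  have hS' : (1 : ℝ) ≤ S := by exact_mod_cast hS
  have hL' : (1 : ℝ) ≤ L := by exact_mod_cast hL
  by_cases hL1 : L = 1
  · subst hL1; simpa using ha.2.le
  · have h1 := le_one_sub_sin_div (mul_pos (mul_pos two_pos ha.1) hpi)
      (h.le_pi ha hS hL fun h => hL1 h.2)
    rw [h.sin_div hS] at h1
    have h2 : 2 * ((S : ℝ) + 1) / ((S : ℝ) * (2 * L + 1)) ≤ 2 / L := by
      rw [div_le_div_iff₀ (by positivity) (by positivity)]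
      nlinarith
    have h3 : (2 * a * Real.pi) ^ 2 / (2 * Real.pi ^ 2) = 2 * a ^ 2 := by field_simp
    have h4 : a ^ 2 ≤ 1 / L := by
      have : 2 / (L : ℝ) = 2 * (1 / L) := by ring
      linarith
    rw [← Real.sqrt_one, ← Real.sqrt_div zero_le_one]
    exact Real.le_sqrt_of_sq_le h4

end Sinc

end VQE

end

theorem theorem2 :
    -- the lower bounds on the expected squared gradient norm
    (∀ (N L S : ℕ), 1 ≤ L → 1 ≤ S →
      ∀ (𝒩 : Finset (Fin N → Fin 4)),
        (∀ i ∈ 𝒩, 1 ≤ VQE.locality i ∧ VQE.locality i ≤ S) →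
      ∀ (E : Fin L → List (VQE.QubitPair N)) (a : ℝ), 0 < a →
        Differentiable ℝ (VQE.cost 𝒩 E) ∧
        Integrable (VQE.gradSq 𝒩 E) (VQE.paramLaw L N a) ∧
        2 * (𝒩.card : ℝ) * ((L : ℝ) - 1) * VQE.alpha a ^ (2 * S * L - 1) * VQE.beta a ^ (S + 1)
          ≤ ∫ θ, VQE.gradSq 𝒩 E θ ∂(VQE.paramLaw L N a) ∧
        (VQE.IsTuned S L a →
          2 * (𝒩.card : ℝ) * (((S : ℝ) + 1) / (Real.exp 1 * S)) ^ (S + 1)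
              * (((L : ℝ) - 1) / (2 * (L : ℝ) + 1) ^ (S + 1))
            ≤ ∫ θ, VQE.gradSq 𝒩 E θ ∂(VQE.paramLaw L N a))) ∧
    -- the equation for `a` has exactly one solution in `(0, 1)`
    (∀ (S L : ℕ), 1 ≤ S → 1 ≤ L → ¬(S = 1 ∧ L = 1) →
      ∃! a : ℝ, a ∈ Set.Ioo (0 : ℝ) 1 ∧ VQE.IsTuned S L a) ∧
    -- the solution is of order `1 / √L`
    (∃ c₁ c₂ : ℝ, 0 < c₁ ∧ 0 < c₂ ∧
      ∀ (S L : ℕ), 1 ≤ S → 1 ≤ L → ∀ a ∈ Set.Ioo (0 : ℝ) 1, VQE.IsTuned S L a →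
        c₁ / Real.sqrt L ≤ a ∧ a ≤ c₂ / Real.sqrt L) := by
  refine ⟨fun N L S hL hS 𝒩 h𝒩 E a ha => ?_, fun S L hS hL h => VQE.existsUnique_isTuned hS hL h,
    1 / Real.pi, 1, by positivity, one_pos,
    fun S L hS hL a ha h => ⟨h.div_sqrt_le ha hS hL, h.le_div_sqrt ha hS hL⟩⟩
  have h := VQE.le_integral_gradSq ha hL 𝒩 h𝒩 E
  exact ⟨VQE.differentiable_cost 𝒩 E, VQE.integrable_paramLaw ha (VQE.continuous_gradSq 𝒩 E), h,
    fun ht => (ht.bound_le hS hL 𝒩.card).trans h⟩
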